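/- Theorem. Let $\Bbbk$ be a field of characteristic zero, let $\beta\in\Bbbk$ with $\beta\neq 0$, and let $n\ge 0$. Let $\mathrm{Fr}(n)$ be the $\Bbbk$-vector space with basis the diffeomorphism classes rel boundary $[S]$ of compact oriented surfaces $S$ without closed components whose boundary is the disjoint union of $n$ circles numbered $1,\dots,n$. By the classification of surfaces, such a class is given by the partition of $\{1,\dots,n\}$ according to the connected components of $S$, together with the genus in $\{0,1,2,\dots\}$ of each component (the genus of a component being that of the closed surface obtained by capping off its boundary circles with disks). Define a bilinear form on $\mathrm{Fr}(n)$ by $([S_1],[S_2])=\alpha((-S_1)\sqcup S_2)$, where $(-S_1)\sqcup S_2$ is the closed surface obtained by gluing $S_1$ (with reversed orientation) and $S_2$ along their common $n$ boundary circles. Here $\alpha$ is the evaluation with constant generating function $Z(T)=\sum_{g\ge 0}\alpha_gT^g=\beta$: the value of a closed oriented surface is the product of the values $\alpha_g$ of its components, where $g$ is the genus of the component, $\alpha_0=\beta$, and $\alpha_g=0$ for $g\ge 1$ (the empty surface has value $1$). Let $A(n)=\mathrm{Fr}(n)/\ker(\,,)$ be the state space of $n$ circles. Then $$\dim_{\Bbbk}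 A(n)=c_n=\frac{1}{n+1}\binom{2n}{n},$$ the $n$-th Catalan number. Moreover, $A(n)$ has a basis consisting of the classes of the crossingless surfaces, that is, of the surfaces $S_\lambda$, one for each non-crossing partition $\lambda$ of $\{1,\dots,n\}$, where $S_\lambda$ has one component for each block of $\lambda$, this component has genus $0$, and its boundary circles are the ones numbered by the elements of the block. (A partition is non-crossing if there are no $i_1<i_2<i_3<i_4$ in $\{1,\dots,n\}$ with $i_1,i_3$ in one block and $i_2,i_4$ in a different block.) -/

import Mathlib

noncomputable section

/-- A compact oriented surface without closed components whose boundary is the disjoint union of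
`n` numbered circles, up to diffeomorphism rel boundary. By the classification of surfaces such a
class is exactly the following datum: the relation "lie on the same connected component" on the
set of the boundary circles, whose equivalence classes are the connected components, together with
the genus of every component (the genus of the closed surface obtained by capping off all its
boundary circles with disks). -/
@[ext]
structure ViewableSurface (n : ℕ) where
  /-- Two boundary circles are related when they lie on the same component. -/
  sameComponent : Setoid (Fin n)
  /-- The genus of each component. -/
  genus : Quotient sameComponent → ℕ

namespace ViewableSurface

variable {n : ℕ}

/-- The connected components of `S`; all of them have nonempty boundary. -/
abbrev Component (S : ViewableSurface n) : Type := Quotient S.sameComponent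

/-- The component of `S` that contains the boundary circle `i`. -/
def componentOf (S : ViewableSurface n) (i : Fin n) : S.Component := Quotient.mk _ i

/-- The Euler characteristic `2 - 2 g - r` of a component of genus `g` with `r` boundary
circles. -/
def eulerChar (S : ViewableSurface n) (a : S.Component) : ℤ :=
  2 - 2 * (S.genus a : ℤ) - (Nat.card {i : Fin n // S.componentOf i = a} : ℤ)

/-- The components of the closed surface `(-S) ⊔ T` obtained by gluing `S` (with the orientation
reversed) and `T` along their common `n` boundary circles: two circles lie on the same component
of the glued surface iff they are connected by a chain of components of `S` and of `T`. Every
component of the glued surface contains at least one of the `n` circles, since neither `S` nor `T`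
has a closed component. -/
abbrev GluedComponent (S T : ViewableSurface n) : Type :=
  Quotient (S.sameComponent ⊔ T.sameComponent)

/-- The component of the glued surface that contains the component `a` of `S`. -/
def gluedLeft (S T : ViewableSurface n) (a : S.Component) : GluedComponent S T :=
  Quotient.map' id (fun _ _ h => (le_sup_left : S.sameComponent ≤ _) h) a

/-- The component of the glued surface that contains the component `b` of `T`. -/
def gluedRight (S T : ViewableSurface n) (b : T.Component) : GluedComponent S T :=
  Quotient.map' id (fun _ _ h => (le_sup_right : T.sameComponent ≤ _) h) b

/-- The Euler characteristic of a component of the glued surface: the Euler characteristic is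
additive under gluing along circles. -/
def gluedEulerChar (S T : ViewableSurface n) (c : GluedComponent S T) : ℤ :=
  (∑ᶠ a : {a : S.Component // gluedLeft S T a = c}, S.eulerChar a.1) +
    ∑ᶠ b : {b : T.Component // gluedRight S T b = c}, T.eulerChar b.1

/-- The genus of a component of the glued surface: the closed connected oriented surface of Euler
characteristic `χ = 2 - 2 g` has genus `g = (2 - χ) / 2`. See `two_sub_two_mul_gluedGenus`: the
number `2 - χ` is always even and nonnegative, so nothing is rounded or truncated here. -/
def gluedGenus (S T : ViewableSurface n) (c : GluedComponent S T) : ℕ :=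
  ((2 - gluedEulerChar S T c) / 2).toNat

theorem gluedLeft_componentOf (S T : ViewableSurface n) (i : Fin n) :
    gluedLeft S T (S.componentOf i) = Quotient.mk _ i := rfl

theorem gluedRight_componentOf (S T : ViewableSurface n) (i : Fin n) :
    gluedRight S T (T.componentOf i) = Quotient.mk _ i := rfl

/-- The gluing pattern of a component `c` is a connected graph, with the pieces of `c` as vertices
and one edge for every circle, so it has at most one vertex more than it has edges. -/
theorem card_pieces_le (S T : ViewableSurface n) (c : GluedComponent S T) :
    Nat.card {a : S.Component // gluedLeft S T a = c} +
      Nat.card {b : T.Component // gluedRight S T b = c} ≤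
    Nat.card {i : Fin n // (Quotient.mk _ i : GluedComponent S T) = c} + 1 := by
  classical
  let I := {i : Fin n // (Quotient.mk _ i : GluedComponent S T) = c}
  let W := {a : S.Component // gluedLeft S T a = c} ⊕ {b : T.Component // gluedRight S T b = c}
  let L : I → W := fun i => Sum.inl ⟨S.componentOf i.1, i.2⟩
  let R : I → W := fun i => Sum.inr ⟨T.componentOf i.1, i.2⟩
  let G : SimpleGraph W := SimpleGraph.fromEdgeSet (Set.range fun i : I => s(L i, R i))
  have hadj : ∀ i : I, G.Adj (L i) (R i) := fun i => by
    rw [SimpleGraph.fromEdgeSet_adj]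
    exact ⟨⟨i, rfl⟩, Sum.inl_ne_inr⟩
  have hreach : ∀ i j : Fin n,
      Relation.EqvGen (fun x y => S.sameComponent x y ∨ T.sameComponent x y) i j →
      ∀ (hi : (Quotient.mk _ i : GluedComponent S T) = c)
        (hj : (Quotient.mk _ j : GluedComponent S T) = c),
        G.Reachable (L ⟨i, hi⟩) (L ⟨j, hj⟩) := by
    intro i j hij
    induction hij with
    | rel x y h =>
      intro hi hj
      rcases h with h | h
      · have : L ⟨x, hi⟩ = L ⟨y, hj⟩ :=
          congrArg Sum.inl (Subtype.ext (Quotient.sound h))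
        rw [this]
      · have : R ⟨x, hi⟩ = R ⟨y, hj⟩ :=
          congrArg Sum.inr (Subtype.ext (Quotient.sound h))
        exact (hadj _).reachable.trans (this ▸ (hadj ⟨y, hj⟩).symm.reachable)
    | refl x => intro hi hj; exact SimpleGraph.Reachable.refl _
    | symm x y _ ih => intro hi hj; exact (ih hj hi).symm
    | trans x y z hxy _ ih1 ih2 =>
      intro hi hj
      have hy : (Quotient.mk _ y : GluedComponent S T) = c := by
        rw [← hi]
        refine (Quotient.sound ?_).symm
        change (S.sameComponent ⊔ T.sameComponent) x y
        rw [Setoid.sup_eq_eqvGen]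
        exact hxy
      exact (ih1 hi hy).trans (ih2 hy hj)
  have hLL : ∀ i j : I, G.Reachable (L i) (L j) := by
    rintro ⟨i, hi⟩ ⟨j, hj⟩
    refine hreach i j ?_ hi hj
    have h := Quotient.exact (hi.trans hj.symm)
    change (S.sameComponent ⊔ T.sameComponent) i j at h
    rw [Setoid.sup_eq_eqvGen] at h
    exact h
  have hW : ∀ w : W, ∃ i : I, G.Reachable w (L i) := by
    rintro (⟨a, ha⟩ | ⟨b, hb⟩)
    · induction a using Quotient.inductionOn with
      | h i => exact ⟨⟨i, ha⟩, SimpleGraph.Reachable.refl _⟩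
    · induction b using Quotient.inductionOn with
      | h i => exact ⟨⟨i, hb⟩, (hadj ⟨i, hb⟩).symm.reachable⟩
  have hne : Nonempty W := by
    induction c using Quotient.inductionOn with
    | h i => exact ⟨L ⟨i, rfl⟩⟩
  have hconn : G.Connected := by
    refine SimpleGraph.Connected.mk fun u v => ?_
    obtain ⟨i, hi⟩ := hW u
    obtain ⟨j, hj⟩ := hW v
    exact hi.trans ((hLL i j).trans hj.symm)
  have h1 := hconn.card_vert_le_card_edgeSet_add_one
  have h2 : Nat.card G.edgeSet ≤ Nat.card I := by
    let e : I → G.edgeSet := fun i => ⟨s(L i, R i), hadj i⟩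
    refine Nat.card_le_card_of_surjective e ?_
    rintro ⟨x, hx⟩
    rw [SimpleGraph.edgeSet_fromEdgeSet] at hx
    obtain ⟨i, hi⟩ := hx.1
    exact ⟨i, Subtype.ext hi⟩
  have h3 : Nat.card W = _ := Nat.card_sum
  rw [← h3]
  exact h1.trans (Nat.add_le_add_right h2 1)

/-- The sum of the Euler characteristics of the pieces of a glued component. -/
theorem finsum_eulerChar (S : ViewableSurface n) {C : Type} (p : S.Component → C) (c : C) :
    ∑ᶠ a : {a : S.Component // p a = c}, S.eulerChar a.1 =
      2 * (Nat.card {a : S.Component // p a = c} : ℤ) -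
        2 * (∑ᶠ a : {a : S.Component // p a = c}, S.genus a.1 : ℕ) -
        (Nat.card {i : Fin n // p (S.componentOf i) = c} : ℤ) := by
  classical
  have e : {i : Fin n // p (S.componentOf i) = c} ≃
      Σ a : {a : S.Component // p a = c}, {i : Fin n // S.componentOf i = a.1} :=
    { toFun := fun i => ⟨⟨S.componentOf i.1, i.2⟩, i.1, rfl⟩
      invFun := fun x => ⟨x.2.1, by rw [x.2.2]; exact x.1.2⟩
      left_inv := fun _ => rfl
      right_inv := by
        rintro ⟨⟨a, ha⟩, i, hi⟩
        change S.componentOf i = a at hi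
        subst hi
        rfl }
  have := Fintype.ofFinite {a : S.Component // p a = c}
  rw [Nat.card_congr e, Nat.card_sigma, finsum_eq_sum_of_fintype, finsum_eq_sum_of_fintype,
    Nat.card_eq_fintype_card]
  simp only [eulerChar, Finset.sum_sub_distrib, ← Finset.mul_sum]
  push_cast
  simp [mul_comm]

/-- The genus of a component of the glued surface is the one given by its Euler characteristic. -/
theorem two_sub_two_mul_gluedGenus (S T : ViewableSurface n) (c : GluedComponent S T) :
    2 - 2 * (gluedGenus S T c : ℤ) = gluedEulerChar S T c := by
  have hV := card_pieces_le S T c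
  have hS := finsum_eulerChar S (gluedLeft S T) c
  have hT := finsum_eulerChar T (gluedRight S T) c
  simp only [gluedLeft_componentOf] at hS
  simp only [gluedRight_componentOf] at hT
  simp only [gluedGenus, gluedEulerChar, hS, hT]
  omega

/-- The closed surface `(-S) ⊔ T`. A closed oriented surface is given, up to diffeomorphism, by
the multiset of the genera of its components. -/
def glue (S T : ViewableSurface n) : Multiset ℕ :=
  have : Fintype (GluedComponent S T) := Fintype.ofFinite _
  (Finset.univ : Finset (GluedComponent S T)).val.map (gluedGenus S T)

/-- The surface `S_λ` attached to a partition `λ` of the `n` circles: its components bound the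
blocks of `λ` and all have genus zero. -/
def ofPartition (P : Setoid (Fin n)) : ViewableSurface n where
  sameComponent := P
  genus := fun _ => 0

end ViewableSurface

/-- The evaluation of a closed oriented surface, given by the genera of its components, with
respect to the generating function `Z(T) = ∑ α_g T ^ g`: multiplicative under disjoint union, and
a connected surface of genus `g` evaluates to `α_g`. -/
def closedEvaluation {k : Type*} [Field k] (Z : PowerSeries k) (M : Multiset ℕ) : k :=
  (M.map fun g => PowerSeries.coeff g Z).prod

/-- The bilinear form on the vector space `Fr(n)` with basis the viewable surfaces with `n`
boundary circles, given by `([S], [T]) = α((-S) ⊔ T)`. -/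
def surfacePairing {k : Type*} [Field k] (Z : PowerSeries k) (n : ℕ) :
    LinearMap.BilinForm k (ViewableSurface n →₀ k) :=
  Finsupp.lift _ k _ fun S => Finsupp.lift k k _ fun T => closedEvaluation Z (S.glue T)

theorem surfacePairing_single {k : Type*} [Field k] (Z : PowerSeries k) (n : ℕ)
    (S T : ViewableSurface n) :
    surfacePairing Z n (Finsupp.single S 1) (Finsupp.single T 1) =
      closedEvaluation Z (S.glue T) := by
  simp [surfacePairing]

/-- The state space `A(n)` of `n` circles for the theory with generating function `Z`: the quotient
of `Fr(n)` by the kernel of the bilinear form. -/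
abbrev StateSpace {k : Type*} [Field k] (Z : PowerSeries k) (n : ℕ) : Type _ :=
  (ViewableSurface n →₀ k) ⧸ LinearMap.ker (surfacePairing Z n)

/-- The class `[S]` of a viewable surface in the state space. -/
def surfaceClass {k : Type*} [Field k] (Z : PowerSeries k) {n : ℕ} (S : ViewableSurface n) :
    StateSpace Z n :=
  Submodule.Quotient.mk (Finsupp.single S 1)

/-- Planar (non-crossing) partitions of `n` points on a line: there are no `i < j < l < m` with
`i, l` in one block and `j, m` in another block. -/
def IsNoncrossing {n : ℕ} (P : Setoid (Fin n)) : Prop :=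
  ∀ i j l m : Fin n, i < j → j < l → l < m → P i l → P j m → P i j

/-- The set of crossingless surfaces: the genus zero surfaces attached to the non-crossing
partitions. -/
def crossinglessSurfaces (n : ℕ) : Set (ViewableSurface n) :=
  {S | ∃ P : Setoid (Fin n), IsNoncrossing P ∧ S = ViewableSurface.ofPartition P}

end

-- Glue two surfaces along the bipartite graph whose vertices are their components and whose edges
-- are the circles. The genus of a glued component is the sum of the genera of its pieces plus the
-- number of independent cycles of its graph. Only spheres have nonzero value, so a surface with a
-- component of positive genus lies in the kernel, and two genus zero surfaces pair to a power of β
-- if the graph is a forest and to 0 otherwise (`closedEvaluation_glue_ofPartition`). Thus A(n) is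
-- identified with the span of the rows of `forestWeight`.
--
-- Spanning. The ways of joining four pieces satisfy a linear relation (`forestWeight_uncrossing`).
-- Around two adjacent points of a non-crossing partition it expresses the partition with these
-- points exchanged through non-crossing ones. Hence the non-crossing span is stable under all
-- permutations, and every partition is a permutation of one whose blocks are intervals.
--
-- Independence. In a relation between non-crossing rows let K be the largest number of blocks that
-- occurs, and test it against partitions Q with n + 1 - K blocks: only partitions with K blocks
-- forming a tree with Q contribute. Tree indicators are squares of determinants with values 0, 1,
-- -1. By polarisation they span all functions p ↦ det(V L_p)², where L_p is the indicator matrix of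
-- the blocks of p. For V = L_qᵀ these form a square matrix, which by Cauchy–Binet is, up to the
-- factor K!², the Gram matrix of rational vectors indexed by pairs of transversals. Evaluation at
-- block minima and maxima shows that these vectors are independent, because a non-crossing
-- partition is determined by its block minima and maxima (`IsNoncrossing.eq_of_forall_min_max`).
--
-- The Catalan number arises by splitting a non-crossing partition at the last point of the block of
-- 0.

universe u

/-! ### Block counts of merged partitions -/

namespace Setoid

variable {α : Type*}

/-- The number of blocks of a partition. -/
noncomputable def blockCount (P : Setoid α) : ℕ := Nat.card (Quotient P)

/-- The partition obtained from `P` by merging the blocks of `a` and `b`. -/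
def merge (P : Setoid α) (a b : α) : Setoid α where
  r x y := P x y ∨ (P x a ∧ P b y) ∨ (P x b ∧ P a y)
  iseqv := by
    refine ⟨fun x => Or.inl (P.refl x), ?_, ?_⟩
    · rintro x y (h | ⟨h, h'⟩ | ⟨h, h'⟩)
      · exact Or.inl (P.symm h)
      · exact Or.inr (Or.inr ⟨P.symm h', P.symm h⟩)
      · exact Or.inr (Or.inl ⟨P.symm h', P.symm h⟩)
    · rintro x y z (h | ⟨h, h'⟩ | ⟨h, h'⟩) (g | ⟨g, g'⟩ | ⟨g, g'⟩)
      · exact Or.inl (P.trans h g)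
      · exact Or.inr (Or.inl ⟨P.trans h g, g'⟩)
      · exact Or.inr (Or.inr ⟨P.trans h g, g'⟩)
      · exact Or.inr (Or.inl ⟨h, P.trans h' g⟩)
      · exact Or.inr (Or.inl ⟨h, g'⟩)
      · exact Or.inl (P.trans h g')
      · exact Or.inr (Or.inr ⟨h, P.trans h' g⟩)
      · exact Or.inl (P.trans h g')
      · exact Or.inr (Or.inr ⟨h, g'⟩)

theorem merge_apply (P : Setoid α) (a b x y : α) :
    P.merge a b x y ↔ P x y ∨ (P x a ∧ P b y) ∨ (P x b ∧ P a y) := Iff.rfl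

theorem le_merge (P : Setoid α) (a b : α) : P ≤ P.merge a b := fun _ _ h => Or.inl h

theorem merge_rel (P : Setoid α) (a b : α) : P.merge a b a b :=
  Or.inr (Or.inl ⟨P.refl a, P.refl b⟩)

theorem merge_le_iff {P R : Setoid α} {a b : α} : P.merge a b ≤ R ↔ P ≤ R ∧ R a b := by
  refine ⟨fun h => ⟨(P.le_merge a b).trans h, h (P.merge_rel a b)⟩, ?_⟩
  rintro ⟨h, hab⟩ x y (g | ⟨g, g'⟩ | ⟨g, g'⟩)
  · exact h g
  · exact R.trans (h g) (R.trans hab (h g'))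
  · exact R.trans (h g) (R.trans (R.symm hab) (h g'))

theorem merge_sup (P Q : Setoid α) (a b : α) : P.merge a b ⊔ Q = (P ⊔ Q).merge a b := by
  apply le_antisymm
  · exact sup_le (merge_le_iff.2 ⟨le_sup_left.trans (le_merge _ a b), merge_rel _ a b⟩)
      (le_sup_right.trans (le_merge _ a b))
  · exact merge_le_iff.2 ⟨sup_le_sup_right (le_merge _ a b) Q,
      (le_sup_left : _ ≤ P.merge a b ⊔ Q) (merge_rel P a b)⟩

theorem merge_eq_self {P : Setoid α} {a b : α} (h : P a b) : P.merge a b = P :=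
  le_antisymm (merge_le_iff.2 ⟨le_rfl, h⟩) (le_merge P a b)

theorem blockCount_merge [Finite α] {P : Setoid α} {a b : α} (h : ¬ P a b) :
    (P.merge a b).blockCount + 1 = P.blockCount := by
  classical
  have := Fintype.ofFinite (Quotient P)
  -- Every block of the merged partition comes from exactly one block of `P` other than that of `b`.
  let f : {q : Quotient P // q ≠ Quotient.mk P b} → Quotient (P.merge a b) :=
    fun q => Quotient.map' id (fun _ _ g => le_merge P a b g) q.1
  have hf : Function.Bijective f := by
    constructor
    · rintro ⟨q, hq⟩ ⟨q', hq'⟩ e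
      induction q using Quotient.inductionOn with
      | h x =>
      induction q' using Quotient.inductionOn with
      | h y =>
      apply Subtype.ext
      have hx : ¬ P x b := fun g => hq (Quotient.sound g)
      have hy : ¬ P y b := fun g => hq' (Quotient.sound g)
      rcases (Quotient.exact e : P.merge a b x y) with g | ⟨_, g⟩ | ⟨g, _⟩
      · exact Quotient.sound g
      · exact absurd (P.symm g) hy
      · exact absurd g hx
    · intro q
      induction q using Quotient.inductionOn with
      | h x =>
      by_cases hx : P x b
      · refine ⟨⟨Quotient.mk P a, fun g => h (Quotient.exact g)⟩, ?_⟩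
        exact Quotient.sound (Or.inr (Or.inl ⟨P.refl a, P.symm hx⟩))
      · exact ⟨⟨Quotient.mk P x, fun g => hx (Quotient.exact g)⟩, rfl⟩
  have h1 := Nat.card_congr (Equiv.ofBijective f hf)
  have h2 : Nat.card {q : Quotient P // q ≠ Quotient.mk P b} + 1 = Nat.card (Quotient P) := by
    simp only [Nat.card_eq_fintype_card, ne_eq, Fintype.card_subtype_compl,
      Fintype.card_subtype_eq]
    have : 0 < Fintype.card (Quotient P) := Fintype.card_pos_iff.2 ⟨Quotient.mk P b⟩
    omega
  rw [blockCount, blockCount, ← h1, h2]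

theorem blockCount_le_merge [Finite α] (P : Setoid α) (a b : α) :
    P.blockCount ≤ (P.merge a b).blockCount + 1 := by
  by_cases h : P a b
  · rw [merge_eq_self h]; omega
  · rw [blockCount_merge h]

end Setoid

/-! ### Genus of glued surfaces and the form on genus zero surfaces -/

namespace ViewableSurface

variable {n : ℕ}

theorem natCard_eq_sum_fiber {A C : Type} [Finite A] [Fintype C] (p : A → C) :
    (Nat.card A : ℤ) = ∑ c, (Nat.card {a // p a = c} : ℤ) := by
  rw [← Nat.card_congr (Equiv.sigmaFiberEquiv p), Nat.card_sigma]
  push_cast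
  rfl

theorem sum_gluedEulerChar_ofPartition (P Q : Setoid (Fin n))
    [Fintype (GluedComponent (ofPartition P) (ofPartition Q))] :
    ∑ c, gluedEulerChar (ofPartition P) (ofPartition Q) c =
      2 * P.blockCount + 2 * Q.blockCount - 2 * n := by
  have h : ∀ c, gluedEulerChar (ofPartition P) (ofPartition Q) c =
      2 * (Nat.card {a : (ofPartition P).Component // gluedLeft (ofPartition P) (ofPartition Q) a = c} : ℤ) +
      2 * (Nat.card {a : (ofPartition Q).Component // gluedRight (ofPartition P) (ofPartition Q) a = c} : ℤ) -
      2 * (Nat.card {i : Fin n // (Quotient.mk _ i : GluedComponent (ofPartition P) (ofPartition Q)) = c} : ℤ) := by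
    intro c
    have hS := finsum_eulerChar (ofPartition P) (gluedLeft (ofPartition P) (ofPartition Q)) c
    have hT := finsum_eulerChar (ofPartition Q) (gluedRight (ofPartition P) (ofPartition Q)) c
    simp only [gluedLeft_componentOf] at hS
    simp only [gluedRight_componentOf] at hT
    simp only [gluedEulerChar, hS, hT]
    simp only [ofPartition, finsum_zero]
    ring
  simp only [h, Finset.sum_sub_distrib, Finset.sum_add_distrib, ← Finset.mul_sum,
    ← natCard_eq_sum_fiber]
  rw [Nat.card_fin]
  rfl

/-- Additivity of the Euler characteristic: the total genus is the first Betti number of the gluing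
graph, which has `n` edges. -/
theorem blockCount_sub_sum_gluedGenus (P Q : Setoid (Fin n))
    [Fintype (GluedComponent (ofPartition P) (ofPartition Q))] :
    P.blockCount + Q.blockCount + ∑ c, gluedGenus (ofPartition P) (ofPartition Q) c =
      n + (P ⊔ Q).blockCount := by
  have h := sum_gluedEulerChar_ofPartition P Q
  simp only [← two_sub_two_mul_gluedGenus, Finset.sum_sub_distrib, ← Finset.mul_sum] at h
  have h2 : ((P ⊔ Q).blockCount : ℤ) =
      Fintype.card (GluedComponent (ofPartition P) (ofPartition Q)) := by
    rw [Setoid.blockCount, ← Nat.card_eq_fintype_card]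
    rfl
  simp only [Finset.sum_const, Finset.card_univ, nsmul_eq_mul] at h
  rw [← h2] at h
  zify
  linarith

/-- The glued genus exceeds the sum of the genera of the pieces by the Betti number of the gluing
graph, which is nonnegative by `card_pieces_le`. -/
theorem genus_le_gluedGenus_left (S T : ViewableSurface n) (a : S.Component) :
    S.genus a ≤ gluedGenus S T (gluedLeft S T a) := by
  set c := gluedLeft S T a with hc
  have hV := card_pieces_le S T c
  have hS := finsum_eulerChar S (gluedLeft S T) c
  have hT := finsum_eulerChar T (gluedRight S T) c
  simp only [gluedLeft_componentOf] at hS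
  simp only [gluedRight_componentOf] at hT
  have h := two_sub_two_mul_gluedGenus S T c
  have hle : S.genus a ≤ ∑ᶠ a : {a : S.Component // gluedLeft S T a = c}, S.genus a.1 :=
    single_le_finsum (f := fun a : {a : S.Component // gluedLeft S T a = c} => S.genus a.1)
      ⟨a, hc.symm⟩ (Set.toFinite _) (fun _ => Nat.zero_le _)
  simp only [gluedEulerChar, hS, hT] at h
  omega

theorem genus_le_gluedGenus_right (S T : ViewableSurface n) (b : T.Component) :
    T.genus b ≤ gluedGenus S T (gluedRight S T b) := by
  set c := gluedRight S T b with hc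
  have hV := card_pieces_le S T c
  have hS := finsum_eulerChar S (gluedLeft S T) c
  have hT := finsum_eulerChar T (gluedRight S T) c
  simp only [gluedLeft_componentOf] at hS
  simp only [gluedRight_componentOf] at hT
  have h := two_sub_two_mul_gluedGenus S T c
  have hle : T.genus b ≤ ∑ᶠ b : {b : T.Component // gluedRight S T b = c}, T.genus b.1 :=
    single_le_finsum (f := fun b : {b : T.Component // gluedRight S T b = c} => T.genus b.1)
      ⟨b, hc.symm⟩ (Set.toFinite _) (fun _ => Nat.zero_le _)
  simp only [gluedEulerChar, hS, hT] at h
  omega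

theorem eq_ofPartition_of_genus_eq_zero {S : ViewableSurface n} (h : ∀ a, S.genus a = 0) :
    S = ofPartition S.sameComponent := by
  obtain ⟨P, g⟩ := S
  have : g = fun _ => 0 := funext h
  subst this
  rfl

variable {k : Type*} [Field k]

theorem closedEvaluation_C_eq_zero (β : k) {M : Multiset ℕ} {g : ℕ} (hg : g ∈ M) (h : g ≠ 0) :
    closedEvaluation (PowerSeries.C β) M = 0 := by
  refine Multiset.prod_eq_zero (Multiset.mem_map.2 ⟨g, hg, ?_⟩)
  rw [PowerSeries.coeff_C, if_neg h]

theorem closedEvaluation_glue_eq_zero_left (β : k) (S T : ViewableSurface n) {a : S.Component}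
    (h : S.genus a ≠ 0) : closedEvaluation (PowerSeries.C β) (S.glue T) = 0 := by
  have := genus_le_gluedGenus_left S T a
  refine closedEvaluation_C_eq_zero β (g := gluedGenus S T (gluedLeft S T a)) ?_ (by omega)
  exact Multiset.mem_map.2 ⟨_, @Finset.mem_univ_val _ (Fintype.ofFinite _) _, rfl⟩

theorem closedEvaluation_glue_eq_zero_right (β : k) (S T : ViewableSurface n) {b : T.Component}
    (h : T.genus b ≠ 0) : closedEvaluation (PowerSeries.C β) (S.glue T) = 0 := by
  have := genus_le_gluedGenus_right S T b
  refine closedEvaluation_C_eq_zero β (g := gluedGenus S T (gluedRight S T b)) ?_ (by omega)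
  exact Multiset.mem_map.2 ⟨_, @Finset.mem_univ_val _ (Fintype.ofFinite _) _, rfl⟩

end ViewableSurface

/-- The value of the closed surface glued from the genus zero surfaces of two partitions: it
vanishes unless the gluing pattern is a forest. -/
noncomputable def forestWeight {α k : Type*} [Field k] (β : k) (P Q : Setoid α) : k :=
  open Classical in
  if P.blockCount + Q.blockCount = Nat.card α + (P ⊔ Q).blockCount then
    β ^ (P ⊔ Q).blockCount else 0

namespace ViewableSurface

variable {n : ℕ} {k : Type*} [Field k]

theorem blockCount_add_le (P Q : Setoid (Fin n)) :
    P.blockCount + Q.blockCount ≤ n + (P ⊔ Q).blockCount := by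
  have : Fintype (GluedComponent (ofPartition P) (ofPartition Q)) := Fintype.ofFinite _
  have := blockCount_sub_sum_gluedGenus P Q
  omega

theorem closedEvaluation_glue_ofPartition (β : k) (P Q : Setoid (Fin n)) :
    closedEvaluation (PowerSeries.C β) ((ofPartition P).glue (ofPartition Q)) =
      forestWeight β P Q := by
  classical
  let _ : Fintype (GluedComponent (ofPartition P) (ofPartition Q)) := Fintype.ofFinite _
  have h := blockCount_sub_sum_gluedGenus P Q
  have e : (∑ c, gluedGenus (ofPartition P) (ofPartition Q) c = 0) ↔
      P.blockCount + Q.blockCount = Nat.card (Fin n) + (P ⊔ Q).blockCount := by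
    rw [Nat.card_fin]; omega
  rw [forestWeight]
  split_ifs with hf
  · rw [← e, Finset.sum_eq_zero_iff] at hf
    rw [closedEvaluation, glue, Multiset.map_map]
    have : ∀ c, PowerSeries.coeff (gluedGenus (ofPartition P) (ofPartition Q) c)
        (PowerSeries.C β) = β := by
      intro c
      rw [hf c (Finset.mem_univ c)]
      simp
    simp only [Function.comp_def, this, Multiset.map_const', Multiset.prod_replicate,
      Finset.card_val, Finset.card_univ]
    rw [Setoid.blockCount, ← Nat.card_eq_fintype_card]
    rfl
  · rw [← e, Finset.sum_eq_zero_iff] at hf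
    push Not at hf
    obtain ⟨c, -, hc⟩ := hf
    exact closedEvaluation_C_eq_zero β
      (Multiset.mem_map.2 ⟨c, @Finset.mem_univ_val _ (Fintype.ofFinite _) _, rfl⟩) hc

/-- Identifying two vertices of the gluing graph that are already connected creates a cycle.
Otherwise the number of cycles is unchanged and one component is lost, hence one factor β. -/
theorem forestWeight_merge (β : k) {P : Setoid (Fin n)} {a b : Fin n}
    (h : ¬ P a b) (Q : Setoid (Fin n)) [Decidable ((P ⊔ Q) a b)] :
    β * forestWeight β (P.merge a b) Q = if (P ⊔ Q) a b then 0 else forestWeight β P Q := by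
  have h1 := Setoid.blockCount_merge h
  have h2 := blockCount_add_le P Q
  rw [forestWeight, forestWeight, Setoid.merge_sup, Nat.card_fin]
  by_cases hE : (P ⊔ Q) a b
  · rw [if_pos hE, Setoid.merge_eq_self hE, if_neg (by omega), mul_zero]
  · have h3 := Setoid.blockCount_merge hE
    rw [if_neg hE]
    by_cases hf : P.blockCount + Q.blockCount = n + (P ⊔ Q).blockCount
    · rw [if_pos (by omega), if_pos hf, ← h3, pow_succ']
    · rw [if_neg (by omega), if_neg hf, mul_zero]

end ViewableSurface

/-! ### Isolating and merging points -/

namespace Setoid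

variable {α : Type u}

/-- The partition obtained from `P` by turning `a` into a block of its own. -/
def isolate (P : Setoid α) (a : α) : Setoid α where
  r x y := x = y ∨ (x ≠ a ∧ y ≠ a ∧ P x y)
  iseqv := by
    refine ⟨fun x => Or.inl rfl, ?_, ?_⟩
    · rintro x y (h | ⟨h, h', g⟩)
      · exact Or.inl h.symm
      · exact Or.inr ⟨h', h, P.symm g⟩
    · rintro x y z (rfl | ⟨h, h', g⟩) (rfl | ⟨k, k', l⟩)
      · exact Or.inl rfl
      · exact Or.inr ⟨k, k', l⟩
      · exact Or.inr ⟨h, h', g⟩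
      · exact Or.inr ⟨h, k', P.trans g l⟩

theorem isolate_apply (P : Setoid α) (a x y : α) :
    P.isolate a x y ↔ x = y ∨ (x ≠ a ∧ y ≠ a ∧ P x y) := Iff.rfl

/-- Describing a partition by the fibres of a map turns the identities below into reasoning about
equalities. -/
theorem exists_eq_ker (P : Setoid α) : ∃ (β : Type u) (f : α → β), P = ker f :=
  ⟨_, Quotient.mk P, (ker_mk_eq P).symm⟩

end Setoid

open Setoid Matrix

theorem IsNoncrossing.isolate {n : ℕ} {P : Setoid (Fin n)} (h : IsNoncrossing P) (a : Fin n) :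
    IsNoncrossing (P.isolate a) := by
  intro x y z w hxy hyz hzw hxz hyw
  simp only [isolate_apply] at *
  have := h x y z w hxy hyz hzw
  grind

/-- No point lies between `i` and `j`, so two points of another block cannot separate them. A
crossing with the merged block would therefore already be a crossing with the block of `i` or of
`j`. -/
theorem IsNoncrossing.merge {n : ℕ} {P : Setoid (Fin n)} (h : IsNoncrossing P) {i j : Fin n}
    (hij : (j : ℕ) = i + 1) : IsNoncrossing (P.merge i j) := by
  obtain ⟨γ, f, rfl⟩ := exists_eq_ker P
  intro a b c d hab hbc hcd hac hbd
  simp only [IsNoncrossing, merge_apply, ker_def] at *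
  have pos : ∀ x : Fin n, i < x ↔ j ≤ x := fun x => by rw [Fin.lt_def, Fin.le_def]; omega
  rcases hac with hac | ⟨h1, h2⟩ | ⟨h1, h2⟩
  · have H := fun x y => h a x c y
    have H' := fun x => h x a b c
    have H'' := fun x => h a b c x
    rcases hbd with hbd | ⟨h3, h4⟩ | ⟨h3, h4⟩
    · exact Or.inl (h a b c d hab hbc hcd hac hbd)
    · have := H j d
      have := H' i
      have := H'' i
      grind
    · have := H i d
      have := H' j
      have := H'' j
      grind
  · rcases hbd with hbd | ⟨h3, h4⟩ | ⟨h3, h4⟩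
    · have := h j b c d
      have := h a b i d
      have := h b c d j
      grind
    · grind
    · grind
  · rcases hbd with hbd | ⟨h3, h4⟩ | ⟨h3, h4⟩
    · have := h i b c d
      have := h a b j d
      have := h b c d i
      grind
    · grind
    · grind

namespace Setoid

section Uncrossing

variable {α : Type u} {P : Setoid α} {i j b c : α}

/-- Isolating `i` and `j` leaves four pieces: the rest of the block of `i` (represented by `b`),
`i`, `j`, and the rest of the block of `j` (represented by `c`). This and the next seven identities
determine the eight terms of the uncrossing relation for these pieces. -/
theorem merge_merge_isolate_eq_self (hb : P i b) (hc : P j c) (hbi : b ≠ i) (hcj : c ≠ j)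
    (hij : ¬ P i j) : (((P.isolate i).isolate j).merge b i).merge j c = P := by
  obtain ⟨γ, f, rfl⟩ := exists_eq_ker P
  simp only [ker_def] at hb hc hij
  ext x y
  simp only [merge_apply, isolate_apply, ker_def]
  grind (splits := 40)

theorem merge_merge_isolate_eq_comap_swap [DecidableEq α] (hb : P i b) (hc : P j c) (hbi : b ≠ i) (hcj : c ≠ j)
    (hij : ¬ P i j) :
    (((P.isolate i).isolate j).merge b j).merge i c = P.comap (Equiv.swap i j) := by
  obtain ⟨γ, f, rfl⟩ := exists_eq_ker P
  simp only [ker_def] at hb hc hij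
  ext x y
  simp only [merge_apply, isolate_apply, comap_rel, ker_def, Equiv.swap_apply_def]
  grind (splits := 40)

theorem merge_merge_isolate_eq_merge_isolate (hb : P i b) (hc : P j c) (hbi : b ≠ i)
    (hcj : c ≠ j) (hij : ¬ P i j) :
    (((P.isolate i).isolate j).merge b c).merge i j =
      (((P.merge i j).isolate i).isolate j).merge i j := by
  obtain ⟨γ, f, rfl⟩ := exists_eq_ker P
  simp only [ker_def] at hb hc hij
  ext x y
  simp only [merge_apply, isolate_apply, ker_def]
  grind (splits := 40)

theorem merge_merge_isolate_left (hb : P i b) (hc : P j c) (hbi : b ≠ i) (hij : ¬ P i j) :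
    (((P.isolate i).isolate j).merge b i).merge i j = (P.isolate j).merge i j := by
  obtain ⟨γ, f, rfl⟩ := exists_eq_ker P
  simp only [ker_def] at hb hc hij
  ext x y
  simp only [merge_apply, isolate_apply, ker_def]
  grind (splits := 40)

theorem merge_merge_isolate_right (hb : P i b) (hc : P j c) (hcj : c ≠ j) (hij : ¬ P i j) :
    (((P.isolate i).isolate j).merge i j).merge j c = (P.isolate i).merge i j := by
  obtain ⟨γ, f, rfl⟩ := exists_eq_ker P
  simp only [ker_def] at hb hc hij
  ext x y
  simp only [merge_apply, isolate_apply, ker_def]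
  grind (splits := 40)

theorem merge_merge_isolate_eq_isolate_right (hb : P i b) (hc : P j c) (hbi : b ≠ i)
    (hcj : c ≠ j) (hij : ¬ P i j) :
    (((P.isolate i).isolate j).merge b i).merge i c = (P.merge i j).isolate j := by
  obtain ⟨γ, f, rfl⟩ := exists_eq_ker P
  simp only [ker_def] at hb hc hij
  ext x y
  simp only [merge_apply, isolate_apply, ker_def]
  grind (splits := 40)

theorem merge_merge_isolate_eq_isolate_left (hb : P i b) (hc : P j c) (hbi : b ≠ i)
    (hcj : c ≠ j) (hij : ¬ P i j) :
    (((P.isolate i).isolate j).merge b j).merge j c = (P.merge i j).isolate i := by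
  obtain ⟨γ, f, rfl⟩ := exists_eq_ker P
  simp only [ker_def] at hb hc hij
  ext x y
  simp only [merge_apply, isolate_apply, ker_def]
  grind (splits := 40)

theorem merge_merge_merge_isolate (hb : P i b) (hc : P j c) (hbi : b ≠ i) (hcj : c ≠ j)
    (hij : ¬ P i j) :
    ((((P.isolate i).isolate j).merge b i).merge i j).merge j c = P.merge i j := by
  obtain ⟨γ, f, rfl⟩ := exists_eq_ker P
  simp only [ker_def] at hb hc hij
  ext x y
  simp only [merge_apply, isolate_apply, ker_def]
  grind (splits := 40)

theorem comap_swap_eq_self [DecidableEq α] (h : P i j) : P.comap (Equiv.swap i j) = P := by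
  obtain ⟨γ, f, rfl⟩ := exists_eq_ker P
  simp only [ker_def] at h
  ext x y
  simp only [comap_rel, ker_def, Equiv.swap_apply_def]
  grind

theorem comap_swap_of_singleton_left [DecidableEq α] (h : ∀ x, P i x → x = i) :
    P.comap (Equiv.swap i j) = (P.merge i j).isolate j := by
  have h' : ∀ x, P x i → x = i := fun x hx => h x (P.symm hx)
  obtain ⟨γ, f, rfl⟩ := exists_eq_ker P
  simp only [ker_def] at h h'
  ext x y
  simp only [comap_rel, merge_apply, isolate_apply, ker_def, Equiv.swap_apply_def]
  grind

theorem comap_swap_of_singleton_right [DecidableEq α] (h : ∀ x, P j x → x = j) :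
    P.comap (Equiv.swap i j) = (P.merge i j).isolate i := by
  have h' : ∀ x, P x j → x = j := fun x hx => h x (P.symm hx)
  obtain ⟨γ, f, rfl⟩ := exists_eq_ker P
  simp only [ker_def] at h h'
  ext x y
  simp only [comap_rel, merge_apply, isolate_apply, ker_def, Equiv.swap_apply_def]
  grind

end Uncrossing

section Comap

variable {α : Type u} (e : Equiv.Perm α)

theorem comap_perm_le_iff {P R : Setoid α} : P.comap e ≤ R ↔ P ≤ R.comap e.symm := by
  constructor
  · intro h x y hxy
    exact h (by simpa [comap_rel] using hxy)
  · intro h x y hxy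
    have := h (show P (e x) (e y) from hxy)
    simpa [comap_rel] using this

theorem comap_perm_sup (P Q : Setoid α) : (P ⊔ Q).comap e = P.comap e ⊔ Q.comap e := by
  apply le_antisymm
  · rw [comap_perm_le_iff]
    exact sup_le ((comap_perm_le_iff e).1 le_sup_left) ((comap_perm_le_iff e).1 le_sup_right)
  · exact sup_le (fun _ _ h => (le_sup_left : P ≤ P ⊔ Q) h)
      (fun _ _ h => (le_sup_right : Q ≤ P ⊔ Q) h)

theorem blockCount_comap_perm (P : Setoid α) : (P.comap e).blockCount = P.blockCount :=
  Nat.card_congr (Quotient.congr e fun _ _ => Iff.rfl)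

end Comap

end Setoid

/-! ### The uncrossing relation and spanning by non-crossing partitions -/

section Span

variable {k : Type*} [Field k] {n : ℕ}

theorem forestWeight_comap_perm {α : Type u} (β : k) (e : Equiv.Perm α) (P Q : Setoid α) :
    forestWeight β (P.comap e) (Q.comap e) = forestWeight β P Q := by
  simp only [forestWeight, ← comap_perm_sup, blockCount_comap_perm]

/-- The uncrossing relation between the ways to join four pieces of a surface. -/
theorem forestWeight_uncrossing {β : k} (hβ : β ≠ 0) {P : Setoid (Fin n)} {a b c d : Fin n}
    (hab : ¬ P a b) (hac : ¬ P a c) (had : ¬ P a d) (hbc : ¬ P b c) (hbd : ¬ P b d)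
    (hcd : ¬ P c d) (Q : Setoid (Fin n)) :
    forestWeight β ((P.merge a b).merge c d) Q + forestWeight β ((P.merge a c).merge b d) Q +
      forestWeight β ((P.merge a d).merge b c) Q + β * forestWeight β (((P.merge a b).merge b c).merge c d) Q =
    forestWeight β ((P.merge a b).merge b c) Q + forestWeight β ((P.merge a b).merge b d) Q +
      forestWeight β ((P.merge a c).merge c d) Q + forestWeight β ((P.merge b c).merge c d) Q := by
  classical
  have hba : ¬ P b a := fun h => hab (P.symm h)
  have hca : ¬ P c a := fun h => hac (P.symm h)
  have hda : ¬ P d a := fun h => had (P.symm h)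
  have hcb : ¬ P c b := fun h => hbc (P.symm h)
  have hdb : ¬ P d b := fun h => hbd (P.symm h)
  have hdc : ¬ P d c := fun h => hcd (P.symm h)
  -- Multiplying by β once per merge reduces every term to the weight of `P`, which survives exactly
  -- when the added edges form a forest on the classes of `P ⊔ Q`.
  have two : ∀ x y z w, ¬ P x y → ¬ P.merge x y z w →
      β * (β * forestWeight β ((P.merge x y).merge z w) Q) =
        if (P ⊔ Q) x y ∨ (P ⊔ Q).merge x y z w then 0 else forestWeight β P Q := by
    intro x y z w h1 h2
    rw [ViewableSurface.forestWeight_merge β h2, merge_sup, mul_ite, mul_zero,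
      ViewableSurface.forestWeight_merge β h1]
    grind
  have three : β * (β * (β * forestWeight β (((P.merge a b).merge b c).merge c d) Q)) =
        if (P ⊔ Q) a b ∨ (P ⊔ Q).merge a b b c ∨ ((P ⊔ Q).merge a b).merge b c c d then 0
          else forestWeight β P Q := by
    have h2 : ¬ P.merge a b b c := by simp [merge_apply, *]
    have h3 : ¬ (P.merge a b).merge b c c d := by simp [merge_apply, *]
    rw [ViewableSurface.forestWeight_merge β h3, merge_sup, merge_sup, mul_ite, mul_zero, mul_ite,
      mul_zero, two a b b c hab h2]
    by_cases h4 : (P ⊔ Q) a b <;> by_cases h5 : (P ⊔ Q).merge a b b c <;>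
      by_cases h6 : ((P ⊔ Q).merge a b).merge b c c d <;> simp only [h4, h5, h6, or_true, or_false,
        if_true, if_false]
  apply mul_left_cancel₀ hβ
  apply mul_left_cancel₀ hβ
  simp only [mul_add, three]
  rw [two a b c d hab (by simp [merge_apply, *]), two a c b d hac (by simp [merge_apply, *]),
    two a d b c had (by simp [merge_apply, *]), two a b b c hab (by simp [merge_apply, *]),
    two a b b d hab (by simp [merge_apply, *]), two a c c d hac (by simp [merge_apply, *]),
    two b c c d hbc (by simp [merge_apply, *])]
  generalize forestWeight β P Q = r
  -- Only the coincidences among the classes of the four points matter. If all are distinct, the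
  -- identity reads 3 + 1 = 4; coincidences kill terms on both sides equally.
  obtain ⟨γ, f, hE⟩ := exists_eq_ker (P ⊔ Q)
  rw [hE]
  simp only [merge_apply, ker_def]
  generalize f a = u, f b = v, f c = w, f d = z
  by_cases h1 : u = v
  · subst h1
    by_cases h2 : u = w
    · subst h2
      simp
    · by_cases h3 : u = z
      · subst h3
        simp [h2, Ne.symm h2]
      · by_cases h4 : w = z
        · subst h4
          simp [h2, Ne.symm h2]
        · simp [h2, h3, h4, Ne.symm h2, Ne.symm h4]
  · by_cases h2 : u = w
    · subst h2
      by_cases h3 : u = z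
      · subst h3
        simp [h1, Ne.symm h1]
      · by_cases h4 : v = z
        · subst h4
          simp [h1, Ne.symm h1]
        · simp [h1, h3, h4, Ne.symm h1, Ne.symm h3]
    · by_cases h3 : u = z
      · subst h3
        by_cases h4 : v = w
        · subst h4
          simp [h1, Ne.symm h1]
        · simp [h1, h2, h4, Ne.symm h1, Ne.symm h2, Ne.symm h4]
      · by_cases h4 : v = w
        · subst h4
          by_cases h5 : v = z
          · subst h5
            simp [h1, Ne.symm h1]
          · simp [h1, h3, h5, Ne.symm h1, Ne.symm h5]
        · by_cases h5 : v = z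
          · subst h5
            simp [h1, h2, h4, Ne.symm h1, Ne.symm h2, Ne.symm h4]
          · by_cases h6 : w = z
            · subst h6
              simp [h1, h2, h4, Ne.symm h1, Ne.symm h2, Ne.symm h4]
            · simp [h1, h2, h3, h4, h5, h6, Ne.symm h1, Ne.symm h2, Ne.symm h4]

/-- The pairing of the genus zero surface of `P` with those of all partitions. -/
noncomputable def weightRow (β : k) (P : Setoid (Fin n)) : Setoid (Fin n) → k := forestWeight β P

/-- The span of the pairings with crossingless surfaces. -/
noncomputable def noncrossingSpan (β : k) (n : ℕ) : Submodule k (Setoid (Fin n) → k) :=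
  Submodule.span k (weightRow β '' {P | IsNoncrossing P})

theorem IsNoncrossing.weightRow_mem {β : k} {P : Setoid (Fin n)} (h : IsNoncrossing P) :
    weightRow β P ∈ noncrossingSpan β n := Submodule.subset_span ⟨P, h, rfl⟩

/-- If `i` or `j` is a singleton, or both lie in one block, the exchanged partition is itself
non-crossing. Otherwise it is one term of an uncrossing relation, and all other terms arise from `P`
by isolating points and merging the neighbours `i` and `j`, which creates no crossing. -/
theorem IsNoncrossing.weightRow_comap_swap_mem {β : k} (hβ : β ≠ 0) {P : Setoid (Fin n)}
    (h : IsNoncrossing P) {i j : Fin n} (hij : (j : ℕ) = i + 1) :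
    weightRow β (P.comap (Equiv.swap i j)) ∈ noncrossingSpan β n := by
  by_cases hP : P i j
  · rw [comap_swap_eq_self hP]
    exact h.weightRow_mem
  by_cases hi : ∀ x, P i x → x = i
  · rw [comap_swap_of_singleton_left hi]
    exact ((h.merge hij).isolate j).weightRow_mem
  by_cases hj : ∀ x, P j x → x = j
  · rw [comap_swap_of_singleton_right hj]
    exact ((h.merge hij).isolate i).weightRow_mem
  push Not at hi hj
  obtain ⟨b, hb, hbi⟩ := hi
  obtain ⟨c, hc, hcj⟩ := hj
  set P₀ := (P.isolate i).isolate j with hP₀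
  -- The uncrossing relation for the pieces `b`, `i`, `j`, `c` of `P₀`, solved for the exchanged
  -- partition.
  have key : weightRow β (P.comap (Equiv.swap i j)) =
      weightRow β ((P.isolate j).merge i j) + weightRow β ((P.merge i j).isolate j) +
      weightRow β ((P.merge i j).isolate i) + weightRow β ((P.isolate i).merge i j) -
      weightRow β P - weightRow β ((((P.merge i j).isolate i).isolate j).merge i j) -
      β • weightRow β (P.merge i j) := by
    obtain ⟨h1, h2, h3, h4, h5, h6⟩ : ¬ P₀ b i ∧ ¬ P₀ b j ∧ ¬ P₀ b c ∧ ¬ P₀ i j ∧ ¬ P₀ i c ∧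
        ¬ P₀ j c := by
      obtain ⟨γ, f, rfl⟩ := exists_eq_ker P
      simp only [hP₀, isolate_apply, ker_def] at *
      grind
    funext Q
    have := forestWeight_uncrossing hβ h1 h2 h3 h4 h5 h6 Q
    simp only [hP₀] at this
    rw [merge_merge_merge_isolate hb hc hbi hcj hP,
      merge_merge_isolate_eq_self hb hc hbi hcj hP,
      merge_merge_isolate_eq_comap_swap hb hc hbi hcj hP,
      merge_merge_isolate_eq_merge_isolate hb hc hbi hcj hP,
      merge_merge_isolate_left hb hc hbi hP,
      merge_merge_isolate_right hb hc hcj hP,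
      merge_merge_isolate_eq_isolate_right hb hc hbi hcj hP,
      merge_merge_isolate_eq_isolate_left hb hc hbi hcj hP] at this
    simp only [weightRow, Pi.add_apply, Pi.sub_apply, Pi.smul_apply, smul_eq_mul]
    linear_combination this
  rw [key]
  refine Submodule.sub_mem _ (Submodule.sub_mem _ (Submodule.sub_mem _ (Submodule.add_mem _
    (Submodule.add_mem _ (Submodule.add_mem _ ?_ ?_) ?_) ?_) ?_) ?_) (Submodule.smul_mem _ _ ?_)
  · exact ((h.isolate j).merge hij).weightRow_mem
  · exact ((h.merge hij).isolate j).weightRow_mem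
  · exact ((h.merge hij).isolate i).weightRow_mem
  · exact ((h.isolate i).merge hij).weightRow_mem
  · exact h.weightRow_mem
  · exact ((((h.merge hij).isolate i).isolate j).merge hij).weightRow_mem
  · exact (h.merge hij).weightRow_mem

/-- The form is invariant under renumbering the circles, and adjacent transpositions generate the
symmetric group. -/
theorem noncrossingSpan_le_comap_funLeft {β : k} (hβ : β ≠ 0) (e : Equiv.Perm (Fin n)) :
    noncrossingSpan β n ≤
      (noncrossingSpan β n).comap (LinearMap.funLeft k k fun Q => Q.comap e.symm) := by
  have row : ∀ (e : Equiv.Perm (Fin n)) (P : Setoid (Fin n)),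
      LinearMap.funLeft k k (fun Q => Q.comap e.symm) (weightRow β P) =
        weightRow β (P.comap e) := by
    intro e P
    funext Q
    rw [LinearMap.funLeft_apply, weightRow, weightRow, ← forestWeight_comap_perm β e]
    congr 1
    ext x y
    simp [comap_rel]
  cases n with
  | zero =>
    have : (fun Q : Setoid (Fin 0) => Q.comap e.symm) = id := by
      funext Q
      ext x
      exact x.elim0
    rw [this]
    exact fun φ hφ => hφ
  | succ n =>
  have he : e ∈ Submonoid.closure
      (Set.range fun i : Fin n => Equiv.swap i.castSucc i.succ) := by
    rw [Equiv.Perm.mclosure_swap_castSucc_succ]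
    trivial
  induction he using Submonoid.closure_induction with
  | mem e he =>
    obtain ⟨i, rfl⟩ := he
    rw [noncrossingSpan, Submodule.span_le]
    rintro _ ⟨P, hP, rfl⟩
    rw [SetLike.mem_coe, Submodule.mem_comap, row]
    exact IsNoncrossing.weightRow_comap_swap_mem hβ hP (by simp)
  | one =>
    intro φ hφ
    exact hφ
  | mul e e' _ _ h h' =>
    intro φ hφ
    exact h' (h hφ)

theorem weightRow_mem_noncrossingSpan {β : k} (hβ : β ≠ 0) (P : Setoid (Fin n)) :
    weightRow β P ∈ noncrossingSpan β n := by
  let f : Fin n → Fin n := fun i => (Quotient.mk P i).out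
  have hf : ∀ i j, f i = f j ↔ P i j := fun i j => by
    simp only [f, Quotient.out_inj]
    exact Quotient.eq
  let σ := Tuple.sort f
  have hmono := Tuple.monotone_sort f
  -- After sorting by representatives every block is an interval: a monotone function with equal
  -- values at `a` and `c` takes that value at `b`.
  have hnc : IsNoncrossing (P.comap σ) := by
    intro a b c d hab hbc _ hac _
    have h : f (σ a) = f (σ c) := (hf _ _).2 hac
    exact (hf _ _).1 (le_antisymm (hmono hab.le) (h ▸ hmono hbc.le))
  have := noncrossingSpan_le_comap_funLeft hβ σ.symm (hnc.weightRow_mem (β := β))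
  rw [Submodule.mem_comap] at this
  convert this using 1
  funext Q
  rw [LinearMap.funLeft_apply, weightRow, weightRow, ← forestWeight_comap_perm β σ]
  rfl

end Span

/-! ### Squared determinants as tree indicators -/

section Determinants

variable {R : Type*} [CommRing R] {n K : ℕ}

/-- The indicator matrix of the fibres of a labelling. -/
def labelMatrix (R : Type*) [CommRing R] (ℓ : Fin n → Fin K) : Matrix (Fin n) (Fin K) R :=
  Matrix.of fun x β => if ℓ x = β then 1 else 0

theorem labelMatrix_apply (ℓ : Fin n → Fin K) (x : Fin n) (β : Fin K) :
    labelMatrix R ℓ x β = if ℓ x = β then 1 else 0 := rfl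

theorem single_vecMul_labelMatrix (ℓ : Fin n → Fin K) (x : Fin n) :
    Pi.single x 1 ᵥ* labelMatrix R ℓ = Pi.single (ℓ x) 1 := by
  ext β
  simp [labelMatrix_apply, Pi.single_apply, eq_comm]

theorem labelMatrix_mulVec (ℓ : Fin n → Fin K) (u : Fin K → R) :
    labelMatrix R ℓ *ᵥ u = u ∘ ℓ := by
  ext x
  simp [labelMatrix_apply, mulVec, dotProduct]

/-- Cauchy–Binet, summed over all maps instead of subsets; each subset is counted once for each of
its `K!` orderings. -/
theorem factorial_mul_det_transpose_mul (A B : Matrix (Fin n) (Fin K) R) :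
    (K.factorial : R) * (Aᵀ * B).det =
      ∑ y : Fin K → Fin n, (A.submatrix y id).det * (B.submatrix y id).det := by
  have h1 : (Aᵀ * B).det = ∑ y : Fin K → Fin n, (∏ j, A (y j) j) * (B.submatrix y id).det := by
    have : (Aᵀ * B : Matrix _ _ R) = fun j => ∑ x, A x j • B x := by
      ext j β
      simp [mul_apply]
    change detRowAlternating (Aᵀ * B) = _
    rw [this, ← AlternatingMap.coe_multilinearMap,
      MultilinearMap.map_sum]
    refine Finset.sum_congr rfl fun y _ => ?_
    rw [MultilinearMap.map_smul_univ]
    rfl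
  have h2 : ∀ σ : Equiv.Perm (Fin K),
      ∑ y : Fin K → Fin n, ((Equiv.Perm.sign σ : ℤ) : R) * (∏ j, A (y (σ j)) j) *
        (B.submatrix y id).det = (Aᵀ * B).det := by
    intro σ
    rw [h1]
    refine Fintype.sum_equiv (Equiv.arrowCongr σ.symm (Equiv.refl _)) _ _ fun y => ?_
    have : B.submatrix (Equiv.arrowCongr σ.symm (Equiv.refl (Fin n)) y) id =
        (B.submatrix y id).submatrix σ id := rfl
    rw [this, det_permute]
    have : ∀ j, Equiv.arrowCongr σ.symm (Equiv.refl (Fin n)) y j = y (σ j) := fun _ => rfl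
    simp only [this]
    ring
  simp only [det_apply' (A.submatrix _ id), submatrix_apply, id, Finset.sum_mul]
  rw [Finset.sum_comm, Finset.sum_congr rfl fun σ _ => h2 σ]
  simp [Fintype.card_perm]

/-- A row of a relative boundary matrix: a point or a difference of two points. -/
def pieceVec (R : Type*) [CommRing R] : Fin n ⊕ (Fin n × Fin n) → Fin n → R
  | .inl x => Pi.single x 1
  | .inr e => Pi.single e.1 1 - Pi.single e.2 1

/-- The squared determinant is a quadratic form in each row. Polarisation, 2uv = u² + v² - (u - v)²,
expresses it through the values at points and at differences of points, with coefficients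
independent of `p`. -/
theorem det_mul_labelMatrix_sq_mem_span {k : Type*} [Field k] [CharZero k] {ι : Type*}
    (ℓ : ι → Fin n → Fin K) (V : Matrix (Fin K) (Fin n) k) :
    (fun p => (V * labelMatrix k (ℓ p)).det ^ 2) ∈ Submodule.span k
      (Set.range fun (ρ : Fin K → Fin n ⊕ (Fin n × Fin n)) p =>
        (Matrix.of (fun j => pieceVec k (ρ j)) * labelMatrix k (ℓ p)).det ^ 2) := by
  set W := Submodule.span k
      (Set.range fun (ρ : Fin K → Fin n ⊕ (Fin n × Fin n)) p =>
        (Matrix.of (fun j => pieceVec k (ρ j)) * labelMatrix k (ℓ p)).det ^ 2)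
  -- `t` contains the rows that are still arbitrary; they are replaced one at a time.
  suffices h : ∀ (t : Finset (Fin K)) (V : Matrix (Fin K) (Fin n) k),
      (∀ j ∉ t, ∃ r, V j = pieceVec k r) →
      (fun p => (V * labelMatrix k (ℓ p)).det ^ 2) ∈ W from
    h Finset.univ V fun j hj => absurd (Finset.mem_univ j) hj
  intro t
  induction t using Finset.induction_on with
  | empty =>
    intro V hV
    choose ρ hρ using fun j => hV j (Finset.notMem_empty j)
    have : V = Matrix.of (fun j => pieceVec k (ρ j)) := funext hρ
    rw [this]
    exact Submodule.subset_span ⟨ρ, rfl⟩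
  | insert j t hj ih =>
    intro V hV
    have basic : ∀ r, (fun p => ((V.updateRow j (pieceVec k r)) * labelMatrix k (ℓ p)).det ^ 2)
        ∈ W := by
      intro r
      refine ih _ fun i hi => ?_
      by_cases hij : i = j
      · exact ⟨r, by rw [hij, updateRow_self]⟩
      · rw [updateRow_ne hij]
        exact hV i (by simp [hi, hij])
    let D : ι → (Fin n → k) →ₗ[k] k := fun p =>
      (detRowAlternating.toMultilinearMap.toLinearMap (V * labelMatrix k (ℓ p)) j).comp
        (labelMatrix k (ℓ p)).vecMulLinear
    have hD : ∀ p v, D p v = (V.updateRow j v * labelMatrix k (ℓ p)).det := by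
      intro p v
      rw [updateRow_mul]
      rfl
    have hq : (fun p => (V * labelMatrix k (ℓ p)).det ^ 2) =
        ∑ x, ∑ y, (V j x * V j y / 2) •
          ((fun p => ((V.updateRow j (pieceVec k (.inl x))) * labelMatrix k (ℓ p)).det ^ 2) +
          (fun p => ((V.updateRow j (pieceVec k (.inl y))) * labelMatrix k (ℓ p)).det ^ 2) -
          (fun p => ((V.updateRow j (pieceVec k (.inr (x, y)))) *
            labelMatrix k (ℓ p)).det ^ 2)) := by
      funext p
      have h1 : (V * labelMatrix k (ℓ p)).det = ∑ x, V j x * D p (Pi.single x 1) := by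
        have h2 := (D p).pi_apply_eq_sum_univ (V j)
        rw [hD, updateRow_eq_self] at h2
        rw [h2]
        refine Finset.sum_congr rfl fun x _ => ?_
        rw [smul_eq_mul]
        congr 2
        ext y
        simp [Pi.single_apply, eq_comm]
      rw [h1, sq, Finset.sum_mul_sum]
      simp only [Finset.sum_apply, Pi.smul_apply, Pi.add_apply, Pi.sub_apply, ← hD, pieceVec,
        map_sub, smul_eq_mul]
      refine Finset.sum_congr rfl fun x _ => Finset.sum_congr rfl fun y _ => ?_
      ring
    rw [hq]
    refine Submodule.sum_mem _ fun x _ => Submodule.sum_mem _ fun y _ => ?_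
    exact Submodule.smul_mem _ _ (Submodule.sub_mem _ (Submodule.add_mem _ (basic _) (basic _))
      (basic _))

/-- The edge of a row relative to a base point. -/
def pieceEdge (x₀ : Fin n) : Fin n ⊕ (Fin n × Fin n) → Fin n × Fin n
  | .inl x => (x₀, x)
  | .inr e => e

/-- The partition generated by the edges of the rows. -/
noncomputable def piecePartition (x₀ : Fin n) (ρ : Fin K → Fin n ⊕ (Fin n × Fin n)) : Setoid (Fin n) :=
  Finset.univ.sup fun j => (⊥ : Setoid (Fin n)).merge (pieceEdge x₀ (ρ j)).1 (pieceEdge x₀ (ρ j)).2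

theorem piecePartition_rel (x₀ : Fin n) (ρ : Fin K → Fin n ⊕ (Fin n × Fin n)) (j : Fin K) :
    piecePartition x₀ ρ (pieceEdge x₀ (ρ j)).1 (pieceEdge x₀ (ρ j)).2 :=
  (merge_le_iff.1 (Finset.le_sup (f := fun j => (⊥ : Setoid (Fin n)).merge (pieceEdge x₀ (ρ j)).1
    (pieceEdge x₀ (ρ j)).2) (Finset.mem_univ j))).2

theorem piecePartition_le {x₀ : Fin n} {ρ : Fin K → Fin n ⊕ (Fin n × Fin n)} {P : Setoid (Fin n)}
    (h : ∀ j, P (pieceEdge x₀ (ρ j)).1 (pieceEdge x₀ (ρ j)).2) : piecePartition x₀ ρ ≤ P :=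
  Finset.sup_le fun j _ => merge_le_iff.2 ⟨bot_le, h j⟩

theorem le_blockCount_sup_merge {ι : Type*} (t : Finset ι) (a b : ι → Fin n) :
    n ≤ (t.sup fun j => (⊥ : Setoid (Fin n)).merge (a j) (b j)).blockCount + t.card := by
  classical
  induction t using Finset.induction_on with
  | empty =>
    have : (⊥ : Setoid (Fin n)).blockCount = n := by
      refine (Nat.card_congr (Equiv.ofBijective (Quotient.mk (⊥ : Setoid (Fin n)))
        ⟨?_, ?_⟩)).symm.trans (Nat.card_fin n)
      · intro x y h
        exact Quotient.exact h
      · exact Quotient.mk_surjective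
    simp [this]
  | insert j t hj ih =>
    rw [Finset.sup_insert, merge_sup, bot_sup_eq, Finset.card_insert_of_notMem hj]
    have := blockCount_le_merge (t.sup fun j => (⊥ : Setoid (Fin n)).merge (a j) (b j)) (a j) (b j)
    omega

/-- The row `j₀` gives the loop at `x₀`, so at most `K - 1` edges merge blocks. -/
theorem le_blockCount_piecePartition {x₀ : Fin n} {ρ : Fin K → Fin n ⊕ (Fin n × Fin n)}
    {j₀ : Fin K} (h₀ : ρ j₀ = .inl x₀) : n + 1 ≤ (piecePartition x₀ ρ).blockCount + K := by
  have h1 : piecePartition x₀ ρ = (Finset.univ.erase j₀).sup fun j =>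
      (⊥ : Setoid (Fin n)).merge (pieceEdge x₀ (ρ j)).1 (pieceEdge x₀ (ρ j)).2 := by
    rw [piecePartition, ← Finset.insert_erase (Finset.mem_univ j₀), Finset.sup_insert,
      Finset.erase_insert_eq_erase, Finset.erase_idem, h₀, pieceEdge,
      merge_eq_self (Setoid.refl' _ _), bot_sup_eq]
  have h2 := le_blockCount_sup_merge (Finset.univ.erase j₀) (fun j => (pieceEdge x₀ (ρ j)).1)
    fun j => (pieceEdge x₀ (ρ j)).2
  rw [← h1, Finset.card_erase_of_mem (Finset.mem_univ _), Finset.card_univ, Fintype.card_fin] at h2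
  have := j₀.pos
  omega

/-- Difference rows annihilate the all-ones vector. -/
theorem det_piece_eq_zero_of_no_point [IsDomain R] (hK : 0 < K) (ℓ : Fin n → Fin K)
    {ρ : Fin K → Fin n ⊕ (Fin n × Fin n)} (h : ∀ j x, ρ j ≠ .inl x) :
    (Matrix.of (fun j => pieceVec R (ρ j)) * labelMatrix R ℓ).det = 0 := by
  rw [← exists_mulVec_eq_zero_iff]
  refine ⟨1, fun h => one_ne_zero (congrFun h ⟨0, hK⟩), ?_⟩
  rw [← mulVec_mulVec, labelMatrix_mulVec]
  ext j
  rcases hj : ρ j with x | e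
  · exact absurd hj (h j x)
  · simp [mulVec, hj, pieceVec, dotProduct, Pi.single_apply]

/-- If the graph is disconnected, the indicator of the labels in a component avoiding `x₀` is a
nonzero vector killed by every row: differences are constant on components, and no point row can
meet that component. -/
theorem det_piece_eq_zero_of_ne_top [IsDomain R] (ℓ : Fin n → Fin K) {x₀ : Fin n}
    {ρ : Fin K → Fin n ⊕ (Fin n × Fin n)} (h : ker ℓ ⊔ piecePartition x₀ ρ ≠ ⊤) :
    (Matrix.of (fun j => pieceVec R (ρ j)) * labelMatrix R ℓ).det = 0 := by
  classical
  set E := ker ℓ ⊔ piecePartition x₀ ρ with hE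
  have hE1 : ∀ {x y}, ℓ x = ℓ y → E x y := fun h => (le_sup_left : ker ℓ ≤ E) h
  have hE2 : ∀ j, E (pieceEdge x₀ (ρ j)).1 (pieceEdge x₀ (ρ j)).2 := fun j =>
    (le_sup_right : piecePartition x₀ ρ ≤ E) (piecePartition_rel x₀ ρ j)
  obtain ⟨x₁, hx₁⟩ : ∃ x₁, ¬ E x₁ x₀ := by
    by_contra! hc
    exact h (Setoid.eq_top_iff.2 fun x y => E.trans (hc x) (E.symm (hc y)))
  rw [← exists_mulVec_eq_zero_iff]
  let u : Fin K → R := fun β => if ∃ x, ℓ x = β ∧ E x₁ x then 1 else 0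
  have hu : ∀ x, u (ℓ x) = if E x₁ x then 1 else 0 := by
    intro x
    simp only [u]
    refine if_congr ⟨?_, fun h => ⟨x, rfl, h⟩⟩ rfl rfl
    rintro ⟨y, hy, hy'⟩
    exact E.trans hy' (hE1 hy)
  refine ⟨u, fun h => ?_, ?_⟩
  · have := congrFun h (ℓ x₁)
    rw [hu, if_pos (E.refl _)] at this
    exact one_ne_zero this
  · rw [← mulVec_mulVec, labelMatrix_mulVec]
    ext j
    have h2 := hE2 j
    rcases hj : ρ j with x | ⟨x, y⟩
    · rw [hj] at h2
      have : ¬ E x₁ x := fun h3 => hx₁ (E.trans h3 (E.symm h2))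
      simp [mulVec, hj, pieceVec, hu, this]
    · rw [hj] at h2
      have : E x₁ x ↔ E x₁ y := ⟨fun h3 => E.trans h3 h2, fun h3 => E.trans h3 (E.symm h2)⟩
      change pieceVec R (ρ j) ⬝ᵥ (u ∘ ℓ) = 0
      rw [hj, pieceVec, sub_dotProduct]
      simp [hu, this]

/-- Over ℤ the rows generate the whole lattice: the base row gives one basis vector, and
connectedness reaches the others along edges. So the determinant is a unit, 1 or -1. -/
theorem det_piece_sq_eq_one_of_eq_top {ℓ : Fin n → Fin K} (hℓ : Function.Surjective ℓ)
    {x₀ : Fin n} {ρ : Fin K → Fin n ⊕ (Fin n × Fin n)} {j₀ : Fin K} (h₀ : ρ j₀ = .inl x₀)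
    (h : ker ℓ ⊔ piecePartition x₀ ρ = ⊤) :
    (Matrix.of (fun j => pieceVec R (ρ j)) * labelMatrix R ℓ).det ^ 2 = 1 := by
  suffices hZ : (Matrix.of (fun j => pieceVec ℤ (ρ j)) * labelMatrix ℤ ℓ).det ^ 2 = 1 by
    have := congrArg (Int.cast : ℤ → R) hZ
    rw [Int.cast_pow, Int.cast_det, Int.cast_one] at this
    convert this using 3
    rw [← Int.coe_castRingHom, Matrix.map_mul]
    congr 1
    · ext j x
      rcases hj : ρ j with x | ⟨x, y⟩ <;> simp [hj, pieceVec, Pi.single_apply]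
    · ext x β
      simp [labelMatrix_apply]
  set M := Matrix.of (fun j => pieceVec ℤ (ρ j)) * labelMatrix ℤ ℓ with hM
  let L := LinearMap.range M.vecMulLinear
  have hrow : ∀ j, pieceVec ℤ (ρ j) ᵥ* labelMatrix ℤ ℓ ∈ L := by
    intro j
    refine ⟨Pi.single j 1, ?_⟩
    rw [vecMulLinear_apply, hM, ← vecMul_vecMul]
    congr 1
    simp
  have hbase : Pi.single (ℓ x₀) 1 ∈ L := by
    have := hrow j₀
    rwa [h₀, pieceVec, single_vecMul_labelMatrix] at this
  -- Points are related when the basis vectors of their labels are congruent modulo the row lattice.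
  let E : Setoid (Fin n) :=
    { r := fun x y => (Pi.single (ℓ x) 1 - Pi.single (ℓ y) 1 : Fin K → ℤ) ∈ L
      iseqv := ⟨fun x => by simp, fun h => by simpa using L.neg_mem h,
        fun h h' => by simpa using L.add_mem h h'⟩ }
  have hE : E = ⊤ := by
    rw [← top_le_iff, ← h]
    refine sup_le ?_ (piecePartition_le fun j => ?_)
    · intro x y hxy
      change (Pi.single (ℓ x) 1 - Pi.single (ℓ y) 1 : Fin K → ℤ) ∈ L
      rw [show ℓ x = ℓ y from hxy, sub_self]
      exact L.zero_mem
    · have := hrow j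
      change (Pi.single (ℓ _) 1 - Pi.single (ℓ _) 1 : Fin K → ℤ) ∈ L
      rcases hj : ρ j with x | ⟨x, y⟩
      · rw [hj, pieceVec, single_vecMul_labelMatrix] at this
        exact L.sub_mem hbase this
      · rw [hj, pieceVec, sub_vecMul, single_vecMul_labelMatrix, single_vecMul_labelMatrix] at this
        exact this
  have hall : ∀ β, ∃ v, v ᵥ* M = Pi.single β 1 := by
    intro β
    obtain ⟨x, rfl⟩ := hℓ β
    have h1 : E x x₀ := by rw [hE]; trivial
    have h2 := L.add_mem (show (Pi.single (ℓ x) 1 - Pi.single (ℓ x₀) 1 : Fin K → ℤ) ∈ L from h1) hbase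
    rw [sub_add_cancel] at h2
    exact h2
  choose N hN using hall
  have h1 : (Matrix.of N) * M = 1 := by
    ext β γ
    exact (congrFun (hN β) γ).trans (by simp [one_apply, Pi.single_apply, eq_comm])
  have h2 : IsUnit M.det := by
    refine IsUnit.of_mul_eq_one_right (Matrix.of N).det ?_
    rw [← det_mul, h1, det_one]
  rcases Int.isUnit_iff.1 h2 with h | h <;> rw [h] <;> norm_num

end Determinants

/-- Reading the points from left to right, a minimum opens a block, and any other point must join
the most recently opened block that is not yet closed; maxima tell when blocks close. -/
theorem IsNoncrossing.eq_of_forall_min_max {n : ℕ} {P P' : Setoid (Fin n)} (h : IsNoncrossing P)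
    (h' : IsNoncrossing P') (hmin : ∀ x, (∀ y, P x y → x ≤ y) ↔ ∀ y, P' x y → x ≤ y)
    (hmax : ∀ x, (∀ y, P x y → y ≤ x) ↔ ∀ y, P' x y → y ≤ x) : P = P' := by
  -- one half of the induction step, stated so that it can be used with `P` and `P'` swapped
  have step : ∀ {P P' : Setoid (Fin n)}, IsNoncrossing P →
      (∀ x, (∀ y, P x y → y ≤ x) ↔ ∀ y, P' x y → y ≤ x) → ∀ x : Fin n,
      (∀ z < x, ∀ y < z, P y z ↔ P' y z) → ∀ y y', y < y' → y' < x → P y x → P' y' x → P y y' := by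
    intro P P' h hmax x ih y y' hyy hyx hy hy'
    by_contra hne
    -- `m` is the last point of the `P`-block of `y'`. Non-crossing forces `m < x`, so this block
    -- closes before `x`, whereas the `P'`-block of `y'` contains `x`.
    obtain ⟨m, hm, hmm⟩ : ∃ m, P y' m ∧ ∀ z, P m z → z ≤ m := by
      obtain ⟨m, hm, hm'⟩ := (Set.toFinite {m | P y' m}).exists_maximal ⟨y', P.refl y'⟩
      exact ⟨m, hm, fun z hz => not_lt.1 fun hlt => absurd (hm' (P.trans hm hz) hlt.le) (not_le.2 hlt)⟩
    have hym : y' ≤ m := hmm y' (P.symm hm)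
    have hmx : m < x := by
      by_contra hc
      rcases (not_lt.1 hc).lt_or_eq with hlt | rfl
      · exact hne (h y y' x m hyy hyx hlt hy hm)
      · exact hne (P.trans hy (P.symm hm))
    have hm' : P' y' m := by
      rcases hym.lt_or_eq with hlt | rfl
      · exact (ih m hmx y' hlt).1 hm
      · exact P'.refl _
    exact absurd ((hmax m).1 hmm x (P'.trans (P'.symm hm') hy')) (not_le.2 hmx)
  have main : ∀ x : Fin n, ∀ y < x, P y x ↔ P' y x := by
    intro x
    induction x using WellFoundedLT.induction with
    | ind x ih =>
    have key : ∀ y < x, ∀ y' < x, P y x → P' y' x → P y y' := by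
      intro y hy y' hy' g g'
      rcases lt_trichotomy y y' with hlt | rfl | hlt
      · exact step h hmax x (fun z hz => ih z hz) y y' hlt hy' g g'
      · exact P.refl _
      · have := step h' (fun x => (hmax x).symm) x (fun z hz y hy => (ih z hz y hy).symm)
          y' y hlt hy g' g
        exact P.symm ((ih y hy y' hlt).2 this)
    have key' : ∀ y < x, ∀ y' < x, P y x → P' y' x → P' y y' := by
      intro y hy y' hy' g g'
      have := key y hy y' hy' g g'
      rcases lt_trichotomy y y' with hlt | rfl | hlt
      · exact (ih y' hy' y hlt).1 this
      · exact P'.refl _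
      · exact P'.symm ((ih y hy y' hlt).1 (P.symm this))
    intro y hy
    constructor
    · intro g
      by_cases hx : ∀ z, P' x z → x ≤ z
      · exact absurd ((hmin x).2 hx y (P.symm g)) (not_le.2 hy)
      · push Not at hx
        obtain ⟨y', hy', hlt⟩ := hx
        exact P'.trans (key' y hy y' hlt g (P'.symm hy')) (P'.symm hy')
    · intro g
      by_cases hx : ∀ z, P x z → x ≤ z
      · exact absurd ((hmin x).1 hx y (P'.symm g)) (not_le.2 hy)
      · push Not at hx
        obtain ⟨y', hy', hlt⟩ := hx
        exact P.trans (P.symm (key y' hlt y hy (P.symm hy') g)) (P.symm hy')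
  ext x y
  rcases lt_trichotomy x y with hlt | rfl | hlt
  · exact main y x hlt
  · exact ⟨fun _ => P'.refl _, fun _ => P.refl _⟩
  · rw [P.comm', P'.comm']
    exact main x y hlt

/-! ### Nonsingularity of the overlap matrix -/

section Labels

variable {n K : ℕ}

theorem Setoid.exists_label {α : Type*} [Finite α] {P : Setoid α} (h : P.blockCount = K) :
    ∃ ℓ : α → Fin K, Function.Surjective ℓ ∧ ker ℓ = P := by
  let e : Quotient P ≃ Fin K := Finite.equivFinOfCardEq h
  refine ⟨fun x => e (Quotient.mk P x), e.surjective.comp Quotient.mk_surjective, ?_⟩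
  ext x y
  rw [ker_def, e.apply_eq_iff_eq]
  exact Quotient.eq

theorem blockCount_ker {α : Type*} {ℓ : α → Fin K} (h : Function.Surjective ℓ) :
    (ker ℓ).blockCount = K :=
  (Nat.card_congr (quotientKerEquivOfSurjective ℓ h)).trans (Nat.card_fin K)

theorem exists_min_section {ℓ : Fin n → Fin K} (h : Function.Surjective ℓ) :
    ∃ m : Fin K → Fin n, (∀ β, ℓ (m β) = β) ∧ ∀ x, m (ℓ x) ≤ x := by
  have : ∀ β, ∃ x, ℓ x = β ∧ ∀ y, ℓ y = β → x ≤ y := by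
    intro β
    obtain ⟨x, hx, hx'⟩ := (Set.toFinite {x | ℓ x = β}).exists_minimal (h β)
    exact ⟨x, hx, fun y hy => (le_total x y).elim id fun g => hx' hy g⟩
  choose m hm hm' using this
  exact ⟨m, hm, fun x => hm' _ x rfl⟩

theorem exists_max_section {ℓ : Fin n → Fin K} (h : Function.Surjective ℓ) :
    ∃ m : Fin K → Fin n, (∀ β, ℓ (m β) = β) ∧ ∀ x, x ≤ m (ℓ x) := by
  have : ∀ β, ∃ x, ℓ x = β ∧ ∀ y, ℓ y = β → y ≤ x := by
    intro β
    obtain ⟨x, hx, hx'⟩ := (Set.toFinite {x | ℓ x = β}).exists_maximal (h β)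
    exact ⟨x, hx, fun y hy => (le_total y x).elim id fun g => hx' hy g⟩
  choose m hm hm' using this
  exact ⟨m, hm, fun x => hm' _ x rfl⟩

/-- The determinant that detects whether `y` is a transversal of the fibres of `ℓ`. -/
def transversalDet (ℓ : Fin n → Fin K) (y : Fin K → Fin n) : ℚ :=
  ((labelMatrix ℚ ℓ).submatrix y id).det

theorem bijective_of_transversalDet_ne_zero {ℓ : Fin n → Fin K} {y : Fin K → Fin n}
    (h : transversalDet ℓ y ≠ 0) : Function.Bijective (ℓ ∘ y) := by
  rw [← Finite.injective_iff_bijective]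
  intro i j hij
  by_contra hne
  refine h (det_zero_of_row_eq hne ?_)
  ext β
  simp only [submatrix_apply, labelMatrix_apply, id]
  rw [show ℓ (y i) = ℓ (y j) from hij]

theorem transversalDet_section {ℓ : Fin n → Fin K} {y : Fin K → Fin n} (h : ∀ β, ℓ (y β) = β) :
    transversalDet ℓ y = 1 := by
  have : (labelMatrix ℚ ℓ).submatrix y id = 1 := by
    ext i j
    simp [labelMatrix_apply, h, one_apply]
  rw [transversalDet, this, det_one]

/-- A triangularity argument. Among the `p` with `x p ≠ 0` choose one with the largest total of
maxima minus minima, and evaluate at its minima and maxima. If `q` also contributes, both are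
transversals of `q`, so the total of `q` is at least as large. Maximality forces the same minima and
maxima, hence `q = p`. -/
theorem eq_zero_of_sum_transversalDet {ι : Type*} [Fintype ι] {ℓ : ι → Fin n → Fin K}
    (hs : ∀ p, Function.Surjective (ℓ p)) (hnc : ∀ p, IsNoncrossing (ker (ℓ p)))
    (hinj : Function.Injective fun p => ker (ℓ p)) {x : ι → ℚ}
    (hx : ∀ y z, ∑ p, x p * (transversalDet (ℓ p) y * transversalDet (ℓ p) z) = 0) : x = 0 := by
  classical
  choose m hm hm' using fun p => exists_min_section (hs p)
  choose M hM hM' using fun p => exists_max_section (hs p)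
  let spread : ι → ℤ := fun p => ∑ β, ((M p β : ℤ) - m p β)
  by_contra hne
  obtain ⟨p₀, hp₀⟩ := Function.ne_iff.1 hne
  obtain ⟨p, hp, hmax⟩ := (Finset.univ.filter fun p => x p ≠ 0).exists_max_image spread
    ⟨p₀, by simpa using hp₀⟩
  have hxp : x p ≠ 0 := by simpa using hp
  have := hx (m p) (M p)
  rw [Finset.sum_eq_single p, transversalDet_section (hm p), transversalDet_section (hM p)] at this
  · simp [hxp] at this
  · intro q _ hqp
    by_contra hq
    have hxq : x q ≠ 0 := left_ne_zero_of_mul hq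
    have b1 := bijective_of_transversalDet_ne_zero (left_ne_zero_of_mul (right_ne_zero_of_mul hq))
    have b2 := bijective_of_transversalDet_ne_zero (right_ne_zero_of_mul (right_ne_zero_of_mul hq))
    have hle := hmax q (by simpa using hxq)
    have e1 : ∑ β, (m q β : ℤ) = ∑ β, (m q (ℓ q (m p β)) : ℤ) :=
      (b1.sum_comp fun β => (m q β : ℤ)).symm
    have e2 : ∑ β, (M q β : ℤ) = ∑ β, (M q (ℓ q (M p β)) : ℤ) :=
      (b2.sum_comp fun β => (M q β : ℤ)).symm
    have l1 : ∀ β ∈ Finset.univ, (m q (ℓ q (m p β)) : ℤ) ≤ m p β := fun β _ => by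
      exact_mod_cast hm' q (m p β)
    have l2 : ∀ β ∈ Finset.univ, (M p β : ℤ) ≤ M q (ℓ q (M p β)) := fun β _ => by
      exact_mod_cast hM' q (M p β)
    have s1 := Finset.sum_le_sum l1
    have s2 := Finset.sum_le_sum l2
    simp only [spread, Finset.sum_sub_distrib] at hle
    have q1 := (Finset.sum_eq_sum_iff_of_le l1).1 (by linarith)
    have q2 := (Finset.sum_eq_sum_iff_of_le l2).1 (by linarith)
    have r1 : ∀ β, m q (ℓ q (m p β)) = m p β := fun β => Fin.ext (by exact_mod_cast q1 β (Finset.mem_univ β))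
    have r2 : ∀ β, M q (ℓ q (M p β)) = M p β := fun β =>
      Fin.ext (by exact_mod_cast (q2 β (Finset.mem_univ β)).symm)
    have cmin : ∀ p x, (∀ y, ker (ℓ p) x y → x ≤ y) ↔ ∃ β, m p β = x := by
      intro p x
      constructor
      · intro h
        exact ⟨ℓ p x, le_antisymm (hm' p x) (h _ (hm p _).symm)⟩
      · rintro ⟨β, rfl⟩ y hy
        rw [ker_def, hm] at hy
        rw [hy]
        exact hm' p y
    have cmax : ∀ p x, (∀ y, ker (ℓ p) x y → y ≤ x) ↔ ∃ β, M p β = x := by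
      intro p x
      constructor
      · intro h
        exact ⟨ℓ p x, le_antisymm (h _ (hM p _).symm) (hM' p x)⟩
      · rintro ⟨β, rfl⟩ y hy
        rw [ker_def, hM] at hy
        rw [hy]
        exact hM' p y
    refine hqp (hinj ((hnc q).eq_of_forall_min_max (hnc p) (fun x => ?_) fun x => ?_))
    · rw [cmin, cmin]
      constructor
      · rintro ⟨β, rfl⟩
        obtain ⟨γ, hγ⟩ := b1.surjective β
        exact ⟨γ, by rw [← r1 γ, ← hγ]; rfl⟩
      · rintro ⟨β, rfl⟩
        exact ⟨_, r1 β⟩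
    · rw [cmax, cmax]
      constructor
      · rintro ⟨β, rfl⟩
        obtain ⟨γ, hγ⟩ := b2.surjective β
        exact ⟨γ, by rw [← r2 γ, ← hγ]; rfl⟩
      · rintro ⟨β, rfl⟩
        exact ⟨_, r2 β⟩
  · simp

/-- The squared overlap determinants of two labellings. -/
def overlapGram (R : Type*) [CommRing R] {ι : Type*} (ℓ : ι → Fin n → Fin K) : Matrix ι ι R :=
  Matrix.of fun p q => ((labelMatrix R (ℓ q))ᵀ * labelMatrix R (ℓ p)).det ^ 2

/-- By Cauchy–Binet, `K!²` times an entry is the inner product of the vectors `transversalDet (ℓ p)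
y * transversalDet (ℓ p) z` over all pairs `(y, z)`. Over ℚ a null vector of a Gram matrix is a
linear relation between the vectors, and there is none. -/
theorem det_overlapGram_ne_zero {k : Type*} [Field k] [CharZero k] {ι : Type*} [Fintype ι]
    [DecidableEq ι] {ℓ : ι → Fin n → Fin K}
    (hs : ∀ p, Function.Surjective (ℓ p)) (hnc : ∀ p, IsNoncrossing (ker (ℓ p)))
    (hinj : Function.Injective fun p => ker (ℓ p)) : (overlapGram k ℓ).det ≠ 0 := by
  -- The entries are rational, so the determinant may be computed in ℚ, where sums of squares are
  -- definite.
  have hmap : overlapGram k ℓ = (overlapGram ℚ ℓ).map (algebraMap ℚ k) := by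
    ext p q
    simp only [overlapGram, map_apply, of_apply, map_pow, RingHom.map_det,
      RingHom.mapMatrix_apply, Matrix.map_mul]
    congr 3
    · ext j x
      simp [labelMatrix_apply, apply_ite (algebraMap ℚ k)]
    · ext j x
      simp [labelMatrix_apply, apply_ite (algebraMap ℚ k)]
  rw [hmap, ← RingHom.mapMatrix_apply, ← RingHom.map_det]
  refine (map_ne_zero _).2 fun h => ?_
  obtain ⟨x, hx, hx0⟩ := exists_mulVec_eq_zero_iff.2 h
  refine hx (eq_zero_of_sum_transversalDet hs hnc hinj ?_)
  have hsum : ∑ y : Fin K → Fin n, ∑ z : Fin K → Fin n,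
      (∑ p, x p * (transversalDet (ℓ p) y * transversalDet (ℓ p) z)) ^ 2 = 0 := by
    have e1 : ∀ p q, ((K.factorial : ℚ) * ((labelMatrix ℚ (ℓ q))ᵀ * labelMatrix ℚ (ℓ p)).det) ^ 2 =
        ∑ y : Fin K → Fin n, ∑ z : Fin K → Fin n,
          (transversalDet (ℓ p) y * transversalDet (ℓ p) z) *
            (transversalDet (ℓ q) y * transversalDet (ℓ q) z) := by
      intro p q
      rw [factorial_mul_det_transpose_mul, sq, Finset.sum_mul_sum]
      refine Finset.sum_congr rfl fun y _ => Finset.sum_congr rfl fun z _ => ?_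
      simp only [transversalDet]
      ring
    have e2 : (K.factorial : ℚ) ^ 2 * (x ⬝ᵥ (overlapGram ℚ ℓ *ᵥ x)) = ∑ p, ∑ q, x p * x q *
        ((K.factorial : ℚ) * ((labelMatrix ℚ (ℓ q))ᵀ * labelMatrix ℚ (ℓ p)).det) ^ 2 := by
      simp only [dotProduct, mulVec, Finset.mul_sum, overlapGram, of_apply]
      refine Finset.sum_congr rfl fun p _ => Finset.sum_congr rfl fun q _ => ?_
      ring
    rw [hx0, dotProduct_zero, mul_zero] at e2
    rw [e2]
    have e3 : ∀ y z, (∑ p, x p * (transversalDet (ℓ p) y * transversalDet (ℓ p) z)) ^ 2 =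
        ∑ p, ∑ q, x p * x q * ((transversalDet (ℓ p) y * transversalDet (ℓ p) z) *
            (transversalDet (ℓ q) y * transversalDet (ℓ q) z)) := by
      intro y z
      rw [sq, Finset.sum_mul_sum]
      refine Finset.sum_congr rfl fun p _ => Finset.sum_congr rfl fun q _ => ?_
      ring
    simp only [e1, e3, Finset.mul_sum]
    rw [Finset.sum_congr rfl fun y _ => Finset.sum_comm, Finset.sum_comm]
    refine Finset.sum_congr rfl fun p _ => ?_
    rw [Finset.sum_congr rfl fun y _ => Finset.sum_comm, Finset.sum_comm]
  intro y z
  have h1 := (Finset.sum_eq_zero_iff_of_nonneg fun y _ =>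
    Finset.sum_nonneg fun z _ => sq_nonneg _).1 hsum y (Finset.mem_univ y)
  have h2 := (Finset.sum_eq_zero_iff_of_nonneg fun z _ => sq_nonneg _).1 h1 z (Finset.mem_univ z)
  exact pow_eq_zero_iff two_ne_zero |>.1 h2

end Labels

/-! ### Linear independence of the non-crossing rows -/

section Independence

variable {k : Type*} [Field k] {n K : ℕ}

theorem finite_setoid {α : Type*} [Finite α] : Finite (Setoid α) :=
  Finite.of_injective (fun P : Setoid α => (P : α → α → Prop)) fun _ _ h =>
    Setoid.ext fun x y => iff_of_eq (congrFun (congrFun h x) y)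

theorem blockCount_eq_one_iff (hn : 0 < n) (P : Setoid (Fin n)) : P.blockCount = 1 ↔ P = ⊤ := by
  have : Nonempty (Quotient P) := ⟨Quotient.mk P ⟨0, hn⟩⟩
  rw [blockCount, Nat.card_eq_one_iff_unique, and_iff_left this, Setoid.eq_top_iff]
  constructor
  · intro h x y
    exact Quotient.exact (Subsingleton.elim (Quotient.mk P x) (Quotient.mk P y))
  · intro h
    refine ⟨fun a b => ?_⟩
    induction a using Quotient.inductionOn
    induction b using Quotient.inductionOn
    exact Quotient.sound (h _ _)

/-- As a functional, `c` kills all tree indicators, hence all squared determinants `det (V *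
labelMatrix k (ℓ p)) ^ 2`. Taking for `V` the transposed label matrices puts `c` in the left kernel
of the nonsingular overlap matrix. -/
theorem eq_zero_of_sum_tree [CharZero k] (hn : 0 < n) (hK : 0 < K) {ι : Type*} [Fintype ι]
    {ℓ : ι → Fin n → Fin K} (hs : ∀ p, Function.Surjective (ℓ p))
    (hnc : ∀ p, IsNoncrossing (ker (ℓ p))) (hinj : Function.Injective fun p => ker (ℓ p))
    {c : ι → k} (hc : ∀ Q : Setoid (Fin n), K + Q.blockCount = n + 1 →
      ∑ p, c p * (open Classical in if ker (ℓ p) ⊔ Q = ⊤ then 1 else 0) = 0) : c = 0 := by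
  classical
  let L : (ι → k) →ₗ[k] k := ∑ p, c p • LinearMap.proj p
  have hL : ∀ f, L f = ∑ p, c p * f p := fun f => by simp [L]
  have hspan : ∀ V : Matrix (Fin K) (Fin n) k,
      L (fun p => (V * labelMatrix k (ℓ p)).det ^ 2) = 0 := by
    intro V
    rw [← LinearMap.mem_ker]
    refine Submodule.span_le.2 ?_ (det_mul_labelMatrix_sq_mem_span ℓ V)
    rintro _ ⟨ρ, rfl⟩
    rw [SetLike.mem_coe, LinearMap.mem_ker, hL]
    by_cases hρ : ∀ j x, ρ j ≠ .inl x
    · refine Finset.sum_eq_zero fun p _ => ?_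
      simp only [det_piece_eq_zero_of_no_point hK (ℓ p) hρ]
      simp
    · push Not at hρ
      obtain ⟨j₀, x₀, h₀⟩ := hρ
      have hval : ∀ p, (Matrix.of (fun j => pieceVec k (ρ j)) * labelMatrix k (ℓ p)).det ^ 2 =
          if ker (ℓ p) ⊔ piecePartition x₀ ρ = ⊤ then 1 else 0 := by
        intro p
        split_ifs with h
        · exact det_piece_sq_eq_one_of_eq_top (hs p) h₀ h
        · rw [det_piece_eq_zero_of_ne_top (ℓ p) h, zero_pow two_ne_zero]
      simp only [hval]
      have hle := le_blockCount_piecePartition h₀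
      -- If `Q` has more than `n + 1 - K` blocks, there are too few edges to connect it with any
      -- `ker (ℓ p)`, and all indicators vanish.
      by_cases heq : K + (piecePartition x₀ ρ).blockCount = n + 1
      · exact hc _ heq
      · refine Finset.sum_eq_zero fun p _ => ?_
        rw [if_neg, mul_zero]
        intro h
        have h1 := ViewableSurface.blockCount_add_le (ker (ℓ p)) (piecePartition x₀ ρ)
        rw [blockCount_ker (hs p), (blockCount_eq_one_iff hn _).2 h] at h1
        omega
  by_contra hne
  refine det_overlapGram_ne_zero (k := k) hs hnc hinj (exists_vecMul_eq_zero_iff.1 ⟨c, hne, ?_⟩)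
  ext q
  exact (hL _).symm.trans (hspan (labelMatrix k (ℓ q))ᵀ)

/-- It suffices to kill the coefficients of the partitions with the largest number of blocks that
occurs, using the test partitions for which the gluing graph can be a tree. -/
theorem weightRow_linearIndependent [CharZero k] {β : k} (hβ : β ≠ 0) :
    LinearIndependent k fun P : {P : Setoid (Fin n) // IsNoncrossing P} => weightRow β P.1 := by
  classical
  have := finite_setoid (α := Fin n)
  have : Fintype {P : Setoid (Fin n) // IsNoncrossing P} := Fintype.ofFinite _
  rw [Fintype.linearIndependent_iff]
  intro c hc
  have hc' : ∀ Q, ∑ P : {P : Setoid (Fin n) // IsNoncrossing P}, c P * forestWeight β P.1 Q = 0 := by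
    intro Q
    simpa [weightRow] using congrFun hc Q
  by_contra! hne
  obtain ⟨P₁, hP₁⟩ := hne
  obtain ⟨P₀, hP₀, hmax⟩ := (Finset.univ.filter fun P => c P ≠ 0).exists_max_image
    (fun P => P.1.blockCount) ⟨P₁, by simpa using hP₁⟩
  have hcP₀ : c P₀ ≠ 0 := by simpa using hP₀
  -- For `n = 0` the only partition has no blocks, and its weight is `β ^ 0 = 1`.
  rcases Nat.eq_zero_or_pos n with rfl | hn
  · have hz : ∀ P : Setoid (Fin 0), P.blockCount = 0 := fun P => by
      rw [blockCount, Nat.card_eq_zero]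
      exact Or.inl ⟨fun q => q.inductionOn fun x => x.elim0⟩
    have hsub : ∀ P : {P : Setoid (Fin 0) // IsNoncrossing P}, P = P₀ := fun P =>
      Subtype.ext (Setoid.ext fun x => x.elim0)
    have := hc' ⊤
    rw [Finset.sum_eq_single P₀ (fun P _ h => absurd (hsub P) h) (by simp), forestWeight] at this
    simp [hz, hcP₀] at this
  set K := P₀.1.blockCount with hKdef
  have hK : 0 < K := by
    have : Nonempty (Quotient P₀.1) := ⟨Quotient.mk _ ⟨0, hn⟩⟩
    exact Nat.card_pos
  have : Fintype {P : Setoid (Fin n) // IsNoncrossing P ∧ P.blockCount = K} := Fintype.ofFinite _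
  choose ℓ hs hker using
    fun p : {P : Setoid (Fin n) // IsNoncrossing P ∧ P.blockCount = K} => exists_label p.2.2
  have h0 : (fun p : {P : Setoid (Fin n) // IsNoncrossing P ∧ P.blockCount = K} =>
      c ⟨p.1, p.2.1⟩) = 0 := by
    refine eq_zero_of_sum_tree hn hK hs (fun p => by rw [hker]; exact p.2.1)
      (fun p q h => Subtype.ext (by simpa only [hker] using h)) fun Q hQ => ?_
    have h1 := hc' Q
    -- With fewer than `K` blocks the forest equation fails; with `K` blocks it says that the graph
    -- is a tree, of weight β; more than `K` blocks have coefficient zero.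
    have h2 : ∀ P : {P : Setoid (Fin n) // IsNoncrossing P}, c P * forestWeight β P.1 Q =
        if P.1.blockCount = K then β * (c P * if P.1 ⊔ Q = ⊤ then 1 else 0) else 0 := by
      intro P
      rw [forestWeight, Nat.card_fin]
      split_ifs with h3 h4 h5 h4 h5
      · rw [h5, (blockCount_eq_one_iff hn _).2 rfl]
        ring
      · exact absurd ((blockCount_eq_one_iff hn _).1 (by omega)) h5
      · by_cases hcP : c P = 0
        · rw [hcP, zero_mul]
        · have := hmax P (by simpa using hcP)
          have hpos : 0 < (P.1 ⊔ Q).blockCount := by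
            have : Nonempty (Quotient (P.1 ⊔ Q)) := ⟨Quotient.mk _ ⟨0, hn⟩⟩
            exact Nat.card_pos
          omega
      · have := (blockCount_eq_one_iff hn _).2 h5
        omega
      · simp
      · simp
    simp only [h2] at h1
    rw [← Finset.sum_filter, ← Finset.mul_sum] at h1
    have h3 := (mul_eq_zero.1 h1).resolve_left hβ
    refine Eq.trans ?_ h3
    refine Finset.sum_bij (fun p _ => ⟨p.1, p.2.1⟩) ?_ ?_ ?_ ?_
    · intro p _
      simpa using p.2.2
    · intro p _ q _ h
      exact Subtype.ext (congrArg (fun P => P.1) h)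
    · intro P hP
      exact ⟨⟨P.1, P.2, by simpa using hP⟩, Finset.mem_univ _, rfl⟩
    · intro p _
      simp only [hker]
  exact hcP₀ (congrFun h0 ⟨P₀.1, P₀.2, rfl⟩)

end Independence

/-! ### Counting non-crossing partitions -/

section Counting

variable {n a b : ℕ}

theorem IsNoncrossing.comap {m n : ℕ} {P : Setoid (Fin n)} (h : IsNoncrossing P)
    {f : Fin m → Fin n} (hf : StrictMono f) : IsNoncrossing (P.comap f) :=
  fun _ _ _ _ hij hjl hlm => h _ _ _ _ (hf hij) (hf hjl) (hf hlm)

/-- The blocks of two partitions placed side by side with one point between them, which joins the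
block of the first point. -/
def arcLabel (n : ℕ) (P : Setoid (Fin a)) (Q : Setoid (Fin b)) (h : a + b = n) (x : Fin (n + 1)) :
    Quotient P ⊕ Option (Quotient Q) :=
  if hx : (x : ℕ) < a then .inl (Quotient.mk P ⟨x, hx⟩)
  else if hx' : a < (x : ℕ) then .inr (some (Quotient.mk Q ⟨x - (a + 1), by omega⟩))
  else if ha : 0 < a then .inl (Quotient.mk P ⟨0, ha⟩) else .inr none

theorem isNoncrossing_ker_arcLabel {P : Setoid (Fin a)} {Q : Setoid (Fin b)}
    (hP : IsNoncrossing P) (hQ : IsNoncrossing Q) (h : a + b = n) :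
    IsNoncrossing (ker (arcLabel n P Q h)) := by
  intro i j l m hij hjl hlm hil hjm
  rw [ker_def] at *
  rw [Fin.lt_def] at hij hjl hlm
  rcases lt_trichotomy (l : ℕ) a with hl | hl | hl
  · have hi : (i : ℕ) < a := by omega
    have hj : (j : ℕ) < a := by omega
    simp only [arcLabel, hl, hi, hj, dif_pos, Sum.inl.injEq, Quotient.eq] at hil hjm ⊢
    by_cases hm : (m : ℕ) < a
    · simp only [hm, dif_pos, Sum.inl.injEq, Quotient.eq] at hjm
      exact hP _ _ _ _ hij hjl hlm hil hjm
    · by_cases hm' : a < (m : ℕ)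
      · simp [hm, hm'] at hjm
      · have ha : 0 < a := by omega
        simp only [hm, hm', ha, dif_pos, dif_neg, not_false_eq_true, Sum.inl.injEq, Quotient.eq] at hjm
        -- Here `m` is the joining point, so `j` lies in the block of 0, and the crossing moves to
        -- the points `0 < i < j < l` of `P`.
        rcases Nat.eq_zero_or_pos (i : ℕ) with h0 | h0
        · simp only [h0]
          exact P.symm hjm
        · have := hP ⟨0, ha⟩ ⟨i, hi⟩ ⟨j, hj⟩ ⟨l, hl⟩ h0 hij hjl (P.symm hjm) hil
          exact P.symm (P.trans hjm this)
  · have hj : (j : ℕ) < a := by omega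
    have hm : ¬ (m : ℕ) < a := by omega
    have hm' : a < (m : ℕ) := by omega
    simp [arcLabel, hj, hm, hm'] at hjm
  · have hl' : ¬ (l : ℕ) < a := by omega
    have hm : ¬ (m : ℕ) < a := by omega
    have hm' : a < (m : ℕ) := by omega
    have hi : ¬ (i : ℕ) < a := by
      intro hi
      simp [arcLabel, hi, hl, hl'] at hil
    have hi' : a < (i : ℕ) := by
      by_contra hi'
      by_cases ha : 0 < a <;> simp [arcLabel, hi, hi', hl, hl', ha] at hil
    have hj : ¬ (j : ℕ) < a := by omega
    have hj' : a < (j : ℕ) := by omega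
    simp only [arcLabel, hi, hj, hl', hm, hi', hj', hl, hm', dif_pos, dif_neg, not_false_eq_true,
      Sum.inr.injEq, Option.some.injEq, Quotient.eq] at hil hjm ⊢
    exact hQ _ _ _ _ (by simp only [Fin.lt_def]; omega) (by simp only [Fin.lt_def]; omega)
      (by simp only [Fin.lt_def]; omega) hil hjm

/-- The arc from 0 to its last partner `a` separates the points before `a` from those after it, so a
partition amounts to its two independent restrictions; `a` itself carries no further choice. -/
theorem card_noncrossing_arc (h : a + b = n) :
    Nat.card {P : Setoid (Fin (n + 1)) // IsNoncrossing P ∧ P 0 ⟨a, by omega⟩ ∧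
      ∀ y, P 0 y → (y : ℕ) ≤ a} =
    Nat.card {P : Setoid (Fin a) // IsNoncrossing P} *
      Nat.card {P : Setoid (Fin b) // IsNoncrossing P} := by
  let f : Fin a → Fin (n + 1) := fun i => ⟨i, by omega⟩
  let g : Fin b → Fin (n + 1) := fun j => ⟨a + 1 + j, by omega⟩
  have hf : StrictMono f := fun i j hij => hij
  have hg : StrictMono g := fun i j hij => by
    simp only [g, Fin.lt_def] at *
    omega
  rw [← Nat.card_prod]
  refine Nat.card_congr (Equiv.ofBijective
    (fun P => (⟨P.1.comap f, P.2.1.comap hf⟩, ⟨P.1.comap g, P.2.1.comap hg⟩)) ⟨?_, ?_⟩)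
  · have half : ∀ {P P' : Setoid (Fin (n + 1))}, IsNoncrossing P → P 0 ⟨a, by omega⟩ →
        (∀ y, P 0 y → (y : ℕ) ≤ a) → P' 0 ⟨a, by omega⟩ → P.comap f = P'.comap f →
        P.comap g = P'.comap g → ∀ x y, x < y → P x y → P' x y := by
      intro P P' hP h1 h2 h3 hPf hPg x y hxy hx
      rw [Fin.lt_def] at hxy
      have hPf' : ∀ i j : Fin a, P (f i) (f j) → P' (f i) (f j) := fun i j hij => by
        have : P.comap f i j := hij
        rwa [hPf] at this
      have hPg' : ∀ i j : Fin b, P (g i) (g j) → P' (g i) (g j) := fun i j hij => by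
        have : P.comap g i j := hij
        rwa [hPg] at this
      rcases lt_trichotomy (y : ℕ) a with hy | hy | hy
      · exact hPf' ⟨x, by omega⟩ ⟨y, hy⟩ hx
      · have e : y = ⟨a, by omega⟩ := Fin.ext hy
        rw [e] at hx ⊢
        refine P'.trans ?_ h3
        exact hPf' ⟨x, by omega⟩ ⟨0, by omega⟩ (P.trans hx (P.symm h1))
      · have hx0 : ¬ P 0 x := fun h0 => absurd (h2 y (P.trans h0 hx)) (not_le.2 hy)
        have hxa : a < (x : ℕ) := by
          by_contra hc
          rcases (not_lt.1 hc).lt_or_eq with hlt | heq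
          · rcases Nat.eq_zero_or_pos (x : ℕ) with hz | hz
            · exact hx0 ((Fin.ext hz : x = 0) ▸ P.refl _)
            · exact hx0 (hP 0 x ⟨a, by omega⟩ y hz hlt hy h1 hx)
          · exact hx0 ((Fin.ext heq : x = ⟨a, by omega⟩) ▸ h1)
        have := hPg' ⟨x - (a + 1), by omega⟩ ⟨y - (a + 1), by omega⟩
        have ex : g ⟨x - (a + 1), by omega⟩ = x := Fin.ext (by simp only [g]; omega)
        have ey : g ⟨y - (a + 1), by omega⟩ = y := Fin.ext (by simp only [g]; omega)
        rw [ex, ey] at this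
        exact this hx
    rintro ⟨P, hP, h1, h2⟩ ⟨P', hP', h1', h2'⟩ heq
    simp only [Prod.mk.injEq, Subtype.mk.injEq] at heq
    apply Subtype.ext
    ext x y
    have A := fun x y hxy => half hP h1 h2 h1' heq.1 heq.2 x y hxy
    have B := fun x y hxy => half hP' h1' h2' h1 heq.1.symm heq.2.symm x y hxy
    rcases lt_trichotomy x y with hlt | rfl | hlt
    · exact ⟨A x y hlt, B x y hlt⟩
    · exact ⟨fun _ => P'.refl _, fun _ => P.refl _⟩
    · exact ⟨fun g => P'.symm (A y x hlt (P.symm g)), fun g => P.symm (B y x hlt (P'.symm g))⟩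
  · rintro ⟨⟨P, hP⟩, ⟨Q, hQ⟩⟩
    refine ⟨⟨ker (arcLabel n P Q h), isNoncrossing_ker_arcLabel hP hQ h, ?_, ?_⟩, ?_⟩
    · rw [ker_def]
      by_cases ha : 0 < a <;> simp [arcLabel, ha]
    · intro y hy
      by_contra hc
      have h1 : ¬ (y : ℕ) < a := by omega
      have h2 : a < (y : ℕ) := by omega
      rw [ker_def] at hy
      by_cases ha : 0 < a <;> simp [arcLabel, ha, h1, h2] at hy
    · simp only [Prod.mk.injEq, Subtype.mk.injEq]
      constructor
      · ext x y
        rw [comap_rel, ker_def]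
        simp only [arcLabel, f, x.2, y.2, dif_pos, Sum.inl.injEq, Quotient.eq]
      · ext x y
        have h1 : ∀ x : Fin b, ¬ a + 1 + (x : ℕ) < a := by omega
        have h2 : ∀ x : Fin b, a < a + 1 + (x : ℕ) := by omega
        rw [comap_rel, ker_def]
        simp only [arcLabel, g, h1, h2, dif_pos, dif_neg, not_false_eq_true, Sum.inr.injEq,
          Option.some.injEq, Quotient.eq, Nat.add_sub_cancel_left]

/-- The Catalan recursion, obtained by sorting the partitions by the last point of the block of 0.
-/
theorem card_noncrossing (n : ℕ) :
    Nat.card {P : Setoid (Fin n) // IsNoncrossing P} = catalan n := by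
  induction n using Nat.strong_induction_on with
  | _ n ih =>
  cases n with
  | zero =>
    rw [catalan_zero, Nat.card_eq_one_iff_unique]
    exact ⟨⟨fun P Q => Subtype.ext (Setoid.ext fun x => x.elim0)⟩, ⟨⟨⊤, fun x => x.elim0⟩⟩⟩
  | succ n =>
    have hex : ∀ P : {P : Setoid (Fin (n + 1)) // IsNoncrossing P}, ∃ x, P.1 0 x ∧
        ∀ y, P.1 0 y → y ≤ x := by
      intro P
      obtain ⟨x, hx, hx'⟩ := (Set.toFinite {x | P.1 0 x}).exists_maximal ⟨0, P.1.refl 0⟩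
      exact ⟨x, hx, fun y hy => (le_total y x).elim id fun g => hx' hy g⟩
    choose m hm hm' using hex
    have := finite_setoid (α := Fin (n + 1))
    rw [← Nat.card_congr (Equiv.sigmaFiberEquiv m), Nat.card_sigma, catalan_succ]
    refine Finset.sum_congr rfl fun i _ => ?_
    rw [← ih i (by omega), ← ih (n - i) (by omega),
      ← card_noncrossing_arc (show (i : ℕ) + (n - i) = n by omega)]
    refine Nat.card_congr
      { toFun := fun P => ⟨P.1.1, P.1.2, ?_, ?_⟩
        invFun := fun P => ⟨⟨P.1, P.2.1⟩, ?_⟩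
        left_inv := fun _ => rfl
        right_inv := fun _ => rfl }
    · have := hm P.1
      rwa [P.2] at this
    · intro y hy
      have := hm' P.1 y hy
      rwa [P.2] at this
    · exact le_antisymm (P.2.2.2 _ (hm ⟨P.1, P.2.1⟩)) (hm' ⟨P.1, P.2.1⟩ _ P.2.2.1)

end Counting

/-! ### The state space and its crossingless basis -/

section StateSpace

variable {k : Type*} [Field k] {n : ℕ}

open ViewableSurface

/-- The genus zero surfaces of the non-crossing partitions are the crossingless surfaces. -/
def noncrossingEquivCrossingless (n : ℕ) :
    {P : Setoid (Fin n) // IsNoncrossing P} ≃ crossinglessSurfaces n where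
  toFun P := ⟨ofPartition P.1, P.1, P.2, rfl⟩
  invFun S := ⟨S.1.sameComponent, by obtain ⟨P, hP, h⟩ := S.2; rw [h]; exact hP⟩
  left_inv _ := rfl
  right_inv S := Subtype.ext (by obtain ⟨_, P, hP, rfl⟩ := S; rfl)

theorem surfaceClass_eq_zero (β : k) {S : ViewableSurface n} {a : S.Component}
    (h : S.genus a ≠ 0) : surfaceClass (PowerSeries.C β) S = 0 := by
  rw [surfaceClass, Submodule.Quotient.mk_eq_zero, LinearMap.mem_ker]
  ext T
  simp [surfacePairing_single, closedEvaluation_glue_eq_zero_left β S T h]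

/-- The pairings with the genus zero surfaces. -/
noncomputable def genusZeroPairing (β : k) (n : ℕ) : (ViewableSurface n →₀ k) →ₗ[k] (Setoid (Fin n) → k) :=
  LinearMap.pi fun Q =>
    LinearMap.flip (surfacePairing (PowerSeries.C β) n) (Finsupp.single (ofPartition Q) 1)

theorem genusZeroPairing_single (β : k) (P : Setoid (Fin n)) :
    genusZeroPairing β n (Finsupp.single (ofPartition P) 1) = weightRow β P := by
  funext Q
  rw [genusZeroPairing, LinearMap.pi_apply, LinearMap.flip_apply, surfacePairing_single,
    closedEvaluation_glue_ofPartition]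
  rfl

/-- Surfaces with a component of positive genus pair to zero with everything, so the genus zero
surfaces already detect the kernel. -/
theorem ker_genusZeroPairing (β : k) :
    LinearMap.ker (genusZeroPairing β n) = LinearMap.ker (surfacePairing (PowerSeries.C β) n) := by
  ext x
  rw [LinearMap.mem_ker, LinearMap.mem_ker]
  constructor
  · intro h
    ext T
    by_cases hT : ∀ b, T.genus b = 0
    · rw [eq_ofPartition_of_genus_eq_zero hT]
      exact congrFun h T.sameComponent
    · push Not at hT
      obtain ⟨b, hb⟩ := hT
      have : LinearMap.flip (surfacePairing (PowerSeries.C β) n) (Finsupp.single T 1) = 0 := by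
        ext S
        simp [surfacePairing_single, closedEvaluation_glue_eq_zero_right β S T hb]
      exact LinearMap.congr_fun this x
  · intro h
    funext Q
    exact LinearMap.congr_fun h (Finsupp.single (ofPartition Q) 1)

/-- The embedding of the state space by the pairings with the genus zero surfaces. -/
noncomputable def stateSpaceEmbedding (β : k) (n : ℕ) :
    StateSpace (PowerSeries.C β) n →ₗ[k] (Setoid (Fin n) → k) :=
  Submodule.liftQ _ (genusZeroPairing β n) (ker_genusZeroPairing β).ge

theorem ker_stateSpaceEmbedding (β : k) : LinearMap.ker (stateSpaceEmbedding β n) = ⊥ :=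
  Submodule.ker_liftQ_eq_bot _ _ _ (ker_genusZeroPairing β).le

theorem stateSpaceEmbedding_surfaceClass (β : k) (P : Setoid (Fin n)) :
    stateSpaceEmbedding β n (surfaceClass (PowerSeries.C β) (ofPartition P)) = weightRow β P :=
  genusZeroPairing_single β P

theorem linearIndependent_crossingless [CharZero k] {β : k} (hβ : β ≠ 0) :
    LinearIndependent k fun S : crossinglessSurfaces n =>
      surfaceClass (PowerSeries.C β) (S : ViewableSurface n) := by
  refine LinearIndependent.of_comp (stateSpaceEmbedding β n) ?_
  rw [← linearIndependent_equiv (noncrossingEquivCrossingless n)]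
  convert weightRow_linearIndependent hβ using 1
  funext P
  exact stateSpaceEmbedding_surfaceClass β P.1

theorem span_crossingless {β : k} (hβ : β ≠ 0) :
    ⊤ ≤ Submodule.span k (Set.range fun S : crossinglessSurfaces n =>
      surfaceClass (PowerSeries.C β) (S : ViewableSurface n)) := by
  set W := Submodule.span k (Set.range fun S : crossinglessSurfaces n =>
      surfaceClass (PowerSeries.C β) (S : ViewableSurface n)) with hW
  have hclass : ∀ S : ViewableSurface n, surfaceClass (PowerSeries.C β) S ∈ W := by
    intro S
    by_cases hS : ∀ a, S.genus a = 0
    · rw [eq_ofPartition_of_genus_eq_zero hS]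
      have h1 := weightRow_mem_noncrossingSpan hβ S.sameComponent
      -- The embedding is injective, so membership in `W` may be checked on rows.
      have h2 : noncrossingSpan β n ≤ W.map (stateSpaceEmbedding β n) := by
        rw [noncrossingSpan, Submodule.span_le]
        rintro _ ⟨P, hP, rfl⟩
        exact ⟨_, Submodule.subset_span ⟨⟨ofPartition P, P, hP, rfl⟩, rfl⟩,
          stateSpaceEmbedding_surfaceClass β P⟩
      obtain ⟨w, hw, hw'⟩ := h2 h1
      rw [← stateSpaceEmbedding_surfaceClass] at hw'
      rwa [← LinearMap.ker_eq_bot.1 (ker_stateSpaceEmbedding β) hw']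
    · push Not at hS
      obtain ⟨a, ha⟩ := hS
      rw [surfaceClass_eq_zero β ha]
      exact W.zero_mem
  rintro x -
  obtain ⟨x, rfl⟩ := Submodule.Quotient.mk_surjective _ x
  induction x using Finsupp.induction_linear with
  | zero => exact W.zero_mem
  | add x y hx hy => exact W.add_mem hx hy
  | single S c =>
    rw [← mul_one c, ← smul_eq_mul, ← Finsupp.smul_single, Submodule.Quotient.mk_smul]
    exact W.smul_mem c (hclass S)

end StateSpace

theorem theorem5p1 {k : Type*} [Field k] [CharZero k] (β : k) (hβ : β ≠ 0) (n : ℕ) :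
    Module.rank k (StateSpace (PowerSeries.C β) n) = (catalan n : Cardinal) ∧
      ∃ b : Module.Basis (crossinglessSurfaces n) k (StateSpace (PowerSeries.C β) n),
        ∀ S : crossinglessSurfaces n, b S = surfaceClass (PowerSeries.C β) (S : ViewableSurface n) := by
  let b := Module.Basis.mk (linearIndependent_crossingless (n := n) hβ) (span_crossingless hβ)
  refine ⟨?_, b, fun S => Module.Basis.mk_apply _ _ S⟩
  have := finite_setoid (α := Fin n)
  have : Finite (crossinglessSurfaces n) := Finite.of_equiv _ (noncrossingEquivCrossingless n)
  have : Fintype (crossinglessSurfaces n) := Fintype.ofFinite _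
  rw [rank_eq_card_basis b, ← Nat.card_eq_fintype_card,
    ← Nat.card_congr (noncrossingEquivCrossingless n), card_noncrossing]
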